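/- Let $1\le k\le n-1$, let $\epsilon_1=\dots=\epsilon_{n-k}=1$, $\epsilon_{n-k+1}=\dots=\epsilon_n=-1$, $J=\mathrm{diag}(\epsilon_1,\dots,\epsilon_n)$, and let $U\subseteq\mathbb{R}^n$ be a simply connected open set containing $0$. All maps are smooth. **Definitions.** An immersion $f:U\to\mathbb{R}^{n+1}$ is an *isothermic$_k$ hypersurface* if its first and second fundamental forms are diagonal in the coordinates $x_1,\dots,x_n$ and $\sum_i\epsilon_i|f_{x_i}|^2=0$. A sequence $(f_1,\dots,f_n)$ of isothermic$_k$ hypersurfaces on $U$ is a *Combescure sequence* if (i) for $1\le l\le n-1$ each $(f_l)_{x_j}$ is parallel to $(f_{l+1})_{x_j}$ at every point, and (ii) there are metric fields $u_l=(u_{l1},\dots,u_{ln})$, i.e. $\mathrm{I}_{f_l}=\sum_j u_{lj}^2\,dx_j^2$, with $(f_l)_{x_j}/u_{lj}=(f_1)_{x_j}/u_{1j}$ for all $l,j$, such that $u_1,\dots,u_n$ are linearly independent at every point. A *null basis* of $\mathbb{R}^{n-k,k}$ is a basis $(c_1,\dots,c_n)$ of $\mathbb{R}^n$ with $c_l^TJc_l=0$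 for all $l$. For $F=(f_{ij}):U\to\mathbb{R}^{n\times n}$ with $f_{ii}=0$ and $\gamma:U\to\mathbb{R}^n$ put $$v=\begin{pmatrix}0&-\xi^TJ\\ \xi&0\end{pmatrix},\quad \xi=(F,\gamma),\qquad a_i=\begin{pmatrix}0&-A_i^TJ\\ A_i&0\end{pmatrix},\quad A_i=(e_{ii},0)\in\mathbb{R}^{n\times(n+1)}.$$ $(F,\gamma)$ is a *solution of the $\frac{\mathrm{O}(2n+1-k,k)}{\mathrm{O}(n+1)\times\mathrm{O}(n-k,k)}$-system* on $U$ if $[a_i,v_{x_j}]-[a_j,v_{x_i}]-[[a_i,v],[a_j,v]]=0$ for all $i\ne j$. An *extended frame* of $(F,\gamma)$ is a family $E_\lambda(x)$, $\lambda\in\mathbb{C}$, $x\in U$, with values in the complexification of $\mathrm{O}(2n+1-k,k)$ (the group preserving the form $\mathrm{diag}(\mathrm{I}_{n+1},J)$), smooth in $x$ and holomorphic in $\lambda$, such that $E_\lambda^{-1}dE_\lambda=\sum_i(a_i\lambda+[a_i,v])\,dx_i$, $\overline{E_{\bar\lambda}}=E_\lambda$ and $\mathrm{I}_{n+1,n}E_{-\lambda}\mathrm{I}_{n+1,n}^{-1}=E_\lambda$,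 where $\mathrm{I}_{n+1,n}=\mathrm{diag}(\mathrm{I}_{n+1},-\mathrm{I}_n)$. **Theorem.** Let $(f_1,\dots,f_n)$ be a Combescure sequence of isothermic$_k$ hypersurfaces in $\mathbb{R}^{n+1}$ defined on $U$, with $f_l(0)=0$ for all $l$. Then there are a solution $(F,\gamma)$ of the $\frac{\mathrm{O}(2n+1-k,k)}{\mathrm{O}(n+1)\times\mathrm{O}(n-k,k)}$-system on $U$, a null basis $(c_1,\dots,c_n)$ of $\mathbb{R}^{n-k,k}$, an extended frame $E_\lambda$ of $(F,\gamma)$ and a map $Y:U\to\mathbb{R}^{(n+1)\times n}$ such that $$\left.\frac{\partial E_\lambda}{\partial\lambda}E_\lambda^{-1}\right|_{\lambda=0}=\begin{pmatrix}0&Y\\-JY^T&0\end{pmatrix}\qquad\text{and}\qquad f_l=Yc_l\quad(1\le l\le n).$$ -/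

import Mathlib

open scoped ContDiff Matrix

namespace Isothermic

noncomputable section

/-! ### Coordinates, partial derivatives, the form of signature `(n - k, k)` -/

/-- The partial derivative `∂g/∂xᵢ` at `x`. -/
def pd {n : ℕ} {V : Type*} [NormedAddCommGroup V] [NormedSpace ℝ V]
    (i : Fin n) (g : (Fin n → ℝ) → V) (x : Fin n → ℝ) : V :=
  fderiv ℝ g x (Pi.single i 1)

/-- The partial derivative `∂M/∂xᵢ` at `x` of a matrix-valued map, taken entrywise. -/
def matPd {n : ℕ} {ι κ V : Type*} [NormedAddCommGroup V] [NormedSpace ℝ V]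
    (i : Fin n) (M : (Fin n → ℝ) → Matrix ι κ V) (x : Fin n → ℝ) : Matrix ι κ V :=
  Matrix.of fun a b => pd i (fun y => M y a b) x

/-- The signs `εᵢ`: the first `n - k` are `1`, the last `k` are `-1`. -/
def eps (n k : ℕ) (i : Fin n) : ℝ := if (i : ℕ) + k < n then 1 else -1

/-- `J = I_{n-k,k} = diag(ε₁, …, εₙ)`. -/
def J (n k : ℕ) : Matrix (Fin n) (Fin n) ℝ := Matrix.diagonal (eps n k)

/-- `c` is a null vector of `ℝ^{n-k,k}`. -/
def IsNull {n : ℕ} (k : ℕ) (c : Fin n → ℝ) : Prop := c ⬝ᵥ (J n k *ᵥ c) = 0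

/-! ### Isothermic hypersurfaces and Combescure sequences -/

/-- `f : U → ℝⁿ⁺¹` is an immersed isothermic_k hypersurface: the coordinates on `U` are line of
curvature coordinates (both fundamental forms are diagonal) and the induced metric
is Guichard_k. -/
structure IsIsothermic {n : ℕ} (k : ℕ) (U : Set (Fin n → ℝ))
    (f : (Fin n → ℝ) → EuclideanSpace ℝ (Fin (n + 1))) : Prop where
  smooth : ContDiffOn ℝ ∞ f U
  immersion : ∀ x ∈ U, LinearIndependent ℝ fun i => pd i f x
  first_diagonal : ∀ x ∈ U, ∀ i j, i ≠ j → inner ℝ (pd i f x) (pd j f x) = 0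
  second_diagonal : ∀ x ∈ U, ∀ N : EuclideanSpace ℝ (Fin (n + 1)),
    (∀ i, inner ℝ N (pd i f x) = 0) →
      ∀ i j, i ≠ j → inner ℝ N (pd i (pd j f) x) = 0
  guichard : ∀ x ∈ U, ∑ i, eps n k i * ‖pd i f x‖ ^ 2 = 0

/-- `f(x) ↦ g(x)` is a Combescure transform: corresponding coordinate tangent vectors
are parallel. -/
def IsCombescureTransform {n : ℕ} (U : Set (Fin n → ℝ))
    (f g : (Fin n → ℝ) → EuclideanSpace ℝ (Fin (n + 1))) : Prop :=
  ∀ x ∈ U, ∀ i, ∃ r : ℝ, r ≠ 0 ∧ pd i g x = r • pd i f x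

/-- `u = (u₁, …, uₙ)` is a metric field of `f`: the induced metric of `f` (which is diagonal for
the hypersurfaces considered here) is `∑ⱼ uⱼ² dxⱼ²`. -/
def IsMetricField {n : ℕ} (U : Set (Fin n → ℝ))
    (f : (Fin n → ℝ) → EuclideanSpace ℝ (Fin (n + 1)))
    (u : (Fin n → ℝ) → Fin n → ℝ) : Prop :=
  ContDiffOn ℝ ∞ u U ∧
    ∀ x ∈ U, ∀ i j, inner ℝ (pd i f x) (pd j f x) = if i = j then u x j ^ 2 else 0

/-- `(f₁, …, fₙ)` is a Combescure sequence of isothermic_k hypersurfaces on `U`. -/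
structure IsCombescureSequence {n : ℕ} (k : ℕ) (U : Set (Fin n → ℝ))
    (f : Fin n → (Fin n → ℝ) → EuclideanSpace ℝ (Fin (n + 1))) : Prop where
  isothermic : ∀ l, IsIsothermic k U (f l)
  combescure : ∀ (l : ℕ) (hl : l + 1 < n),
    IsCombescureTransform U (f ⟨l, Nat.lt_of_succ_lt hl⟩) (f ⟨l + 1, hl⟩)
  independent : ∃ u : Fin n → (Fin n → ℝ) → Fin n → ℝ,
    (∀ l, IsMetricField U (f l) (u l)) ∧
    (∀ x ∈ U, ∀ l m j, (u l x j)⁻¹ • pd j (f l) x = (u m x j)⁻¹ • pd j (f m) x) ∧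
    ∀ x ∈ U, LinearIndependent ℝ fun l => u l x

/-! ### The `O(2n+1-k,k) / (O(n+1) × O(n-k,k))`-system -/

/-- Index type of the `(2n+1) × (2n+1)` matrices, split as `(n+1) + n`. -/
abbrev Idx (n : ℕ) : Type := Fin (n + 1) ⊕ Fin n

/-- The element `(0, -ξᵀJ; ξ, 0)` of the `-1`-eigenspace `𝔭`, for `ξ` an `n × (n+1)` matrix. -/
def pElt {n : ℕ} (k : ℕ) (ξ : Matrix (Fin n) (Fin (n + 1)) ℝ) : Matrix (Idx n) (Idx n) ℝ :=
  Matrix.fromBlocks 0 (-(ξᵀ * J n k)) ξ 0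

/-- The basis element `aᵢ` of the maximal abelian subalgebra: `ξ = (eᵢᵢ, 0)`. -/
def a {n : ℕ} (k : ℕ) (i : Fin n) : Matrix (Idx n) (Idx n) ℝ :=
  pElt k (Matrix.single i i.castSucc 1)

/-- The `n × (n+1)` matrix `ξ = (F, γ)`. -/
def joinCol {n : ℕ} (F : Matrix (Fin n) (Fin n) ℝ) (γ : Fin n → ℝ) :
    Matrix (Fin n) (Fin (n + 1)) ℝ :=
  Matrix.of fun i => Fin.snoc (F i) (γ i)

/-- The `𝔭`-valued map `v` with `ξ = (F, γ)`. -/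
def vMap {n : ℕ} (k : ℕ) (F : (Fin n → ℝ) → Matrix (Fin n) (Fin n) ℝ)
    (γ : (Fin n → ℝ) → Fin n → ℝ) (x : Fin n → ℝ) : Matrix (Idx n) (Idx n) ℝ :=
  pElt k (joinCol (F x) (γ x))

/-- The commutator `[A, B] = AB - BA` of matrices. -/
def comm {ι : Type*} [Fintype ι] (A B : Matrix ι ι ℝ) : Matrix ι ι ℝ := A * B - B * A

/-- `(F, γ)` is a smooth solution on `U` of the system
`[aᵢ, v_{xⱼ}] - [aⱼ, v_{xᵢ}] - [[aᵢ, v], [aⱼ, v]] = 0`, `i ≠ j`. -/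
structure IsSolution {n : ℕ} (k : ℕ) (U : Set (Fin n → ℝ))
    (F : (Fin n → ℝ) → Matrix (Fin n) (Fin n) ℝ) (γ : (Fin n → ℝ) → Fin n → ℝ) : Prop where
  smooth_F : ∀ i j, ContDiffOn ℝ ∞ (fun x => F x i j) U
  smooth_γ : ContDiffOn ℝ ∞ γ U
  diag_zero : ∀ x ∈ U, ∀ i, F x i i = 0
  pde : ∀ x ∈ U, ∀ i j, i ≠ j →
    comm (a k i) (matPd j (vMap k F γ) x) - comm (a k j) (matPd i (vMap k F γ) x)
      - comm (comm (a k i) (vMap k F γ x)) (comm (a k j) (vMap k F γ x)) = 0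

/-- The `dxᵢ`-coefficient `aᵢ λ + [aᵢ, v]` of the Lax pair `θ_λ`. -/
def lax {n : ℕ} (k : ℕ) (F : (Fin n → ℝ) → Matrix (Fin n) (Fin n) ℝ)
    (γ : (Fin n → ℝ) → Fin n → ℝ) (z : ℂ) (i : Fin n) (x : Fin n → ℝ) :
    Matrix (Idx n) (Idx n) ℂ :=
  z • (a k i).map Complex.ofReal + (comm (a k i) (vMap k F γ x)).map Complex.ofReal

/-- The Gram matrix `diag(I_{n+1}, J)` of the form that defines `O(2n+1-k, k)`. -/
def gram (n k : ℕ) : Matrix (Idx n) (Idx n) ℂ :=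
  Matrix.fromBlocks 1 0 0 ((J n k).map Complex.ofReal)

/-- `I_{n+1,n}`; the involution is conjugation by it. -/
def invol (n : ℕ) : Matrix (Idx n) (Idx n) ℂ := Matrix.fromBlocks 1 0 0 (-1)

/-- `E_λ(x)`, written `E z x`, is an extended frame of `(F, γ)` on `U`: it takes values in the
complexification of `O(2n+1-k, k)`, is smooth in `x` and holomorphic in `λ`, satisfies
`E⁻¹ dE = θ_λ` and the reality condition. -/
structure IsExtendedFrame {n : ℕ} (k : ℕ) (U : Set (Fin n → ℝ))
    (F : (Fin n → ℝ) → Matrix (Fin n) (Fin n) ℝ) (γ : (Fin n → ℝ) → Fin n → ℝ)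
    (E : ℂ → (Fin n → ℝ) → Matrix (Idx n) (Idx n) ℂ) : Prop where
  smooth : ∀ z p q, ContDiffOn ℝ ∞ (fun x => E z x p q) U
  holomorphic : ∀ x ∈ U, ∀ p q, Differentiable ℂ fun z => E z x p q
  mem_group : ∀ z, ∀ x ∈ U, (E z x)ᵀ * gram n k * E z x = gram n k
  parallel : ∀ z, ∀ x ∈ U, ∀ i, (E z x)⁻¹ * matPd i (E z) x = lax k F γ z i x
  real : ∀ z, ∀ x ∈ U, (E (starRingEnd ℂ z) x).map (starRingEnd ℂ) = E z x
  twisted : ∀ z, ∀ x ∈ U, invol n * E (-z) x * (invol n)⁻¹ = E z x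

/-- `∂E/∂λ · E⁻¹` at `λ = 0`. -/
def symMap {n : ℕ} (E : ℂ → (Fin n → ℝ) → Matrix (Idx n) (Idx n) ℂ) (x : Fin n → ℝ) :
    Matrix (Idx n) (Idx n) ℂ :=
  (Matrix.of fun p q => deriv (fun z => E z x p q) 0) * (E 0 x)⁻¹

/-- The sequence `f` is constructed on `U` from `(F, γ)` and `C`: for some extended frame `E` of
`(F, γ)`, with `∂E/∂λ · E⁻¹ = (0, Y; -JYᵀ, 0)` at `λ = 0`, one has `f_l = Y c_l`. -/
def IsConstructedFrom {n : ℕ} (k : ℕ) (U : Set (Fin n → ℝ))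
    (F : (Fin n → ℝ) → Matrix (Fin n) (Fin n) ℝ) (γ : (Fin n → ℝ) → Fin n → ℝ)
    (C : Fin n → Fin n → ℝ)
    (f : Fin n → (Fin n → ℝ) → EuclideanSpace ℝ (Fin (n + 1))) : Prop :=
  ∃ (E : ℂ → (Fin n → ℝ) → Matrix (Idx n) (Idx n) ℂ)
    (Y : (Fin n → ℝ) → Matrix (Fin (n + 1)) (Fin n) ℝ),
    IsExtendedFrame k U F γ E ∧
    (∀ x ∈ U, symMap E x =
      (Matrix.fromBlocks 0 (Y x) (-(J n k * (Y x)ᵀ)) 0).map Complex.ofReal) ∧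
    ∀ l, ∀ x ∈ U, f l x = WithLp.toLp 2 (Y x *ᵥ C l)

end

end Isothermic

/-!
The hypersurfaces `f l` share their unit principal directions `e₁, …, eₙ`, hence also the unit
normal `N`, so one orthogonal frame `g = (e₁, …, eₙ, N)` and the matrix `W = (W_{i l})` of metric
fields describe the whole sequence through `∂ᵢ f_l = W_{i l} eᵢ` (`exists_isFrame`). Symmetry of
second derivatives and diagonality of the second fundamental form force `gᵀ ∂ᵢg` to be concentrated
in row and column `i` (`IsFrame.conn_eq_zero`); it is therefore the upper block of `[aᵢ, v]` for a unique
`ξ = (F, γ)` with `F` of zero diagonal. The same symmetry together with the differentiated Guichard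
condition says that `W` solves `∂ᵢW = Dᵢᵀ W`, where `Dᵢ` is the lower block of `[aᵢ, v]`
(`IsFrame.matPd_W`). As `W` is invertible, `E₀ = diag(g, (W W(0)⁻¹)ᵀ)` is an orthogonal frame with
`E₀⁻¹ ∂ᵢE₀ = [aᵢ, v]`. The mere existence of `E₀` gives the system for `(F, γ)`
(`pde_of_frame`).

The Guichard condition at `0` says that the columns of `C = -J W(0)` are null vectors. Define `Y` by
`Y C = (f₁, …, fₙ)` and `Z = (0, Y; -J Yᵀ, 0)`. Then `∂ᵢZ = E₀ aᵢ E₀⁻¹`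
(`IsFrame.matPd_skewBlock_mul`), so the matrices `∂ᵢZ` commute with each other. An extended frame is
`E_λ = G_λ E₀` with `G_λ` the solution of `dG = λ G dZ`, `G(0) = 1`. It is obtained as a power
series in `λ` whose coefficients are iterated primitives `dG_{m+1} = G_m dZ`
(`exists_isIteratedPrimitive`): commutativity makes each of these forms closed, and closed forms
on a simply connected open set are exact (`exists_primitive_of_isSimplyConnected`). The series
converges locally uniformly for every `λ` (`IsIteratedPrimitive.exists_ball_summable`). The
coefficient of `λ` is `Z`, which gives `∂E/∂λ E⁻¹ = Z` at `λ = 0`. Orthogonality holds since `dZ` is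
skew for the form; the reality and twisting conditions hold since complex conjugation fixes `dZ`,
the involution negates it, and the iterated primitives inherit this
(`IsIteratedPrimitive.map_genSeries`).
-/

namespace Isothermic

open Set Filter Topology

/-! ### Closed forms on simply connected open sets -/

/-- Local maps `h p : N p → V` on a simply connected space whose pairwise differences are locally
constant can be corrected by locally constant maps to a single global map `H`. The corrections are
the germs of a section of the covering with discrete fibre `V` and transition maps
`v ↦ v + (h p - h q)`; a section exists because the identity of a simply connected space lifts
through every covering. -/
theorem exists_glue_of_locally_constant_differences {X V : Type*} [TopologicalSpace X]
    [SimplyConnectedSpace X] [LocallyPathConnectedSpace X] [AddCommGroup V]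
    (N : X → Set X) (hN : ∀ p, IsOpen (N p)) (hmem : ∀ p, p ∈ N p) (h : X → X → V)
    (hh : ∀ p q, ∀ x ∈ N p ∩ N q, ∀ᶠ y in 𝓝 x, h p y - h q y = h p x - h q x) :
    ∃ H : X → V, ∀ p, ∀ x ∈ N p, ∀ᶠ y in 𝓝 x, H y - h p y = H x - h p x := by
  -- the discrete topology makes the fibre bundle below a covering map
  let : TopologicalSpace V := ⊥
  have : DiscreteTopology V := ⟨rfl⟩
  let Z : FiberBundleCore X X V :=
    { baseSet := N
      isOpen_baseSet := hN
      indexAt := id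
      mem_baseSet_at := hmem
      coordChange := fun p q x v => v + (h p x - h q x)
      coordChange_self := by simp
      continuousOn_coordChange := by
        rintro p q ⟨x, v⟩ ⟨hx, -⟩
        refine (continuousAt_const (y := v + (h p x - h q x))).congr ?_ |>.continuousWithinAt
        have h1 : ∀ᶠ y : X × V in 𝓝 (x, v), h p y.1 - h q y.1 = h p x - h q x :=
          (continuous_fst.tendsto (x, v)).eventually (hh p q x hx)
        have h2 : ∀ᶠ y : X × V in 𝓝 (x, v), y.2 = v :=
          (continuous_snd.tendsto (x, v)).eventually ((isOpen_discrete {v}).mem_nhds rfl)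
        filter_upwards [h1, h2] with y h1 h2
        rw [h1, h2]
      coordChange_comp := by intros; abel }
  have cov : IsCoveringMap (Bundle.TotalSpace.proj : Bundle.TotalSpace V Z.Fiber → X) :=
    FiberBundle.isCoveringMap
  obtain ⟨x₀⟩ : Nonempty X := inferInstance
  obtain ⟨s, ⟨-, hs⟩, -⟩ := cov.existsUnique_continuousMap_lifts (ContinuousMap.id X) x₀
    ⟨x₀, (0 : V)⟩ rfl
  have hs' : ∀ x, (s x).proj = x := fun x => congrFun hs x
  -- the germ `s x` is the germ at `x` of `h x + (s x).2`
  let c : X → V := fun x => (s x).2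
  refine ⟨fun x => c x + h x x, fun p x hx => ?_⟩
  have hloc : ∀ y, (Z.localTriv p (s y)).2 = c y + (h y y - h p y) := by
    intro y
    rw [Z.localTriv_apply]
    change c y + (h (s y).proj (s y).proj - h p (s y).proj) = _
    rw [hs']
  have hsrc : s x ∈ (Z.localTriv p).source := by
    rw [Z.mem_localTriv_source]
    change (s x).proj ∈ N p
    rwa [hs']
  have hcont : ContinuousAt (fun y => (Z.localTriv p (s y)).2) x :=
    continuousAt_snd.comp (((Z.localTriv p).continuousAt hsrc).comp s.continuous.continuousAt)
  have := hcont.eventually ((isOpen_discrete {(Z.localTriv p (s x)).2}).mem_nhds rfl)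
  filter_upwards [this] with y hy
  have hy : (Z.localTriv p (s y)).2 = (Z.localTriv p (s x)).2 := hy
  rw [hloc, hloc] at hy
  rw [add_sub_assoc, hy, add_sub_assoc]

/-- The Poincaré lemma on a simply connected open set: a differentiable 1-form with symmetric
derivative is exact. On balls this is the convex case of the lemma, and two primitives on
overlapping balls differ by a locally constant map. -/
theorem exists_primitive_of_isSimplyConnected {E V : Type*} [NormedAddCommGroup E]
    [NormedSpace ℝ E] [NormedAddCommGroup V] [NormedSpace ℝ V] [CompleteSpace V] {U : Set E}
    (hU : IsOpen U) (hUs : IsSimplyConnected U) {η : E → E →L[ℝ] V}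
    (hη : DifferentiableOn ℝ η U)
    (hsymm : ∀ x ∈ U, ∀ v w, fderiv ℝ η x v w = fderiv ℝ η x w v) (x₀ : E) (v₀ : V) :
    ∃ H : E → V, H x₀ = v₀ ∧ ∀ x ∈ U, HasFDerivAt H (η x) x := by
  classical
  have := hUs.simplyConnectedSpace
  have := hU.locallyPathConnectedSpace
  have hball : ∀ p : U, ∃ r > 0, Metric.ball (p : E) r ⊆ U := fun p =>
    Metric.isOpen_iff.1 hU p p.2
  choose r hr hrU using hball
  have hloc : ∀ p : U, ∃ h : E → V, ∀ x ∈ Metric.ball (p : E) (r p), HasFDerivAt h (η x) x :=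
    fun p => (convex_ball _ _).exists_forall_hasFDerivAt_of_fderiv_symmetric Metric.isOpen_ball
      (hη.mono (hrU p)) fun x hx => hsymm x (hrU p hx)
  choose h hh using hloc
  obtain ⟨H, hH⟩ := exists_glue_of_locally_constant_differences
    (fun p : U => (Subtype.val ⁻¹' Metric.ball (p : E) (r p) : Set U))
    (fun p => Metric.isOpen_ball.preimage continuous_subtype_val)
    (fun p => Metric.mem_ball_self (hr p)) (fun p x => h p x) (by
      rintro p q x ⟨hxp, hxq⟩
      obtain ⟨δ, hδ, hδs⟩ := Metric.isOpen_iff.1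
        ((Metric.isOpen_ball (x := (p : E)) (ε := r p)).inter
          (Metric.isOpen_ball (x := (q : E)) (ε := r q))) x ⟨hxp, hxq⟩
      have hd : ∀ y ∈ Metric.ball (x : E) δ,
          HasFDerivAt (fun y => h p y - h q y) (0 : E →L[ℝ] V) y := by
        intro y hy
        simpa using (hh p y (hδs hy).1).fun_sub (hh q y (hδs hy).2)
      have hev : ∀ᶠ y : U in 𝓝 x, (y : E) ∈ Metric.ball (x : E) δ :=
        continuousAt_subtype_val.eventually (Metric.ball_mem_nhds _ hδ)
      filter_upwards [hev] with y hy
      exact Metric.isOpen_ball.is_const_of_fderiv_eq_zero (𝕜 := ℝ)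
        (convex_ball (x : E) δ).isPreconnected
        (fun z hz => (hd z hz).differentiableAt.differentiableWithinAt)
        (fun z hz => (hd z hz).fderiv) hy (Metric.mem_ball_self hδ))
  let K : E → V := fun x => if hx : x ∈ U then H ⟨x, hx⟩ else 0
  have hK : ∀ x ∈ U, HasFDerivAt K (η x) x := by
    intro x hx
    have h1 := hH ⟨x, hx⟩ ⟨x, hx⟩ (Metric.mem_ball_self (hr _))
    have h2 : ∀ᶠ y in 𝓝 x, K y = h ⟨x, hx⟩ y + (K x - h ⟨x, hx⟩ x) := by
      have h1' := (eventually_nhds_subtype_iff U ⟨x, hx⟩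
        (fun y => K y - h ⟨x, hx⟩ y = K x - h ⟨x, hx⟩ x)).1 (by
          filter_upwards [h1] with y hy
          simpa [K, hx] using hy)
      rw [hU.nhdsWithin_eq hx] at h1'
      filter_upwards [h1'] with y hy
      rw [← hy]; abel
    exact ((hh ⟨x, hx⟩ x (Metric.mem_ball_self (hr _))).add_const _).congr_of_eventuallyEq h2
  refine ⟨fun x => K x + (v₀ - K x₀), by simp, fun x hx => (hK x hx).add_const _⟩

/-! ### Iterated primitives -/

lemma two_le_infty : (2 : WithTop ℕ∞) ≤ ∞ := WithTop.coe_le_coe.2 (le_top (a := (2 : ℕ∞)))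

section Series

variable {E 𝔸 : Type*} [NormedAddCommGroup E] [NormedSpace ℝ E] [NormedRing 𝔸] [NormedAlgebra ℝ 𝔸]

/-- The `𝔸`-valued 1-form `v ↦ g * η v`. -/
noncomputable def mulForm (g : 𝔸) (η : E →L[ℝ] 𝔸) : E →L[ℝ] 𝔸 :=
  (ContinuousLinearMap.mul ℝ 𝔸 g).comp η

@[simp] lemma mulForm_apply (g : 𝔸) (η : E →L[ℝ] 𝔸) (v : E) : mulForm g η v = g * η v := rfl

lemma norm_mulForm_le (g : 𝔸) (η : E →L[ℝ] 𝔸) : ‖mulForm g η‖ ≤ ‖g‖ * ‖η‖ :=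
  ContinuousLinearMap.opNorm_le_bound _ (by positivity) fun v => by
    rw [mulForm_apply, mul_assoc]
    exact (norm_mul_le _ _).trans (by gcongr; exact η.le_opNorm v)

/-- `IsIteratedPrimitive U Z x₀ G`: on `U`, `G 0 = 1` and `G (m + 1)` is the primitive of
`G m * dZ` that vanishes at `x₀`. -/
structure IsIteratedPrimitive (U : Set E) (Z : E → 𝔸) (x₀ : E) (G : ℕ → E → 𝔸) : Prop where
  zero : G 0 = 1
  base : ∀ m, G (m + 1) x₀ = 0
  hasFDerivAt_succ : ∀ m, ∀ x ∈ U, HasFDerivAt (G (m + 1)) (mulForm (G m x) (fderiv ℝ Z x)) x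

/-- If `dg` is a left multiple of `dZ` and the values of `dZ` commute, then `g * dZ` is closed:
`d(g dZ) = dg ∧ dZ = K dZ ∧ dZ = 0`. -/
lemma exists_primitive_mulForm [CompleteSpace 𝔸] {U : Set E} (hU : IsOpen U)
    (hUs : IsSimplyConnected U) {Z : E → 𝔸} (hZ : ContDiffOn ℝ ∞ Z U)
    (hcomm : ∀ x ∈ U, ∀ v w, Commute (fderiv ℝ Z x v) (fderiv ℝ Z x w)) (x₀ : E)
    {g : E → 𝔸} (hg : ∀ x ∈ U, ∃ K, HasFDerivAt g (mulForm K (fderiv ℝ Z x)) x) :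
    ∃ g' : E → 𝔸, g' x₀ = 0 ∧ ∀ x ∈ U, HasFDerivAt g' (mulForm (g x) (fderiv ℝ Z x)) x := by
  have key : ∀ x ∈ U, ∃ D : E →L[ℝ] E →L[ℝ] 𝔸,
      HasFDerivAt (fun x => mulForm (g x) (fderiv ℝ Z x)) D x ∧ ∀ v w, D v w = D w v := by
    intro x hx
    obtain ⟨K, hK⟩ := hg x hx
    have hZx : ContDiffAt ℝ ∞ Z x := hZ.contDiffAt (hU.mem_nhds hx)
    have h2 : HasFDerivAt (fderiv ℝ Z) (fderiv ℝ (fderiv ℝ Z) x) x :=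
      ((hZx.fderiv_right (m := 1)
      (one_add_one_eq_two (R := WithTop ℕ∞) ▸ two_le_infty)).differentiableAt
        (by simp)).hasFDerivAt
    refine ⟨_, (((ContinuousLinearMap.mul ℝ 𝔸).hasFDerivAt (x := g x)).comp x hK).clm_comp h2,
      fun v w => ?_⟩
    have hs : fderiv ℝ (fderiv ℝ Z) x v w = fderiv ℝ (fderiv ℝ Z) x w v :=
      (hZx.isSymmSndFDerivAt (by simpa using two_le_infty)) v w
    simp [hs, mul_assoc, (hcomm x hx v w).eq]
  refine exists_primitive_of_isSimplyConnected hU hUs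
    (fun x hx => (key x hx).choose_spec.1.differentiableAt.differentiableWithinAt)
    (fun x hx v w => ?_) x₀ 0
  obtain ⟨D, hD, hs⟩ := key x hx
  rw [hD.fderiv, hs]

/-- The iterated primitives exist if the values of `dZ` commute: each `dG m` is a left multiple of
`dZ`, so that the form `G m * dZ` is closed again. -/
theorem exists_isIteratedPrimitive [CompleteSpace 𝔸] {U : Set E} (hU : IsOpen U)
    (hUs : IsSimplyConnected U) {Z : E → 𝔸} (hZ : ContDiffOn ℝ ∞ Z U)
    (hcomm : ∀ x ∈ U, ∀ v w, Commute (fderiv ℝ Z x v) (fderiv ℝ Z x w)) (x₀ : E) :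
    ∃ G, IsIteratedPrimitive U Z x₀ G := by
  let T := {g : E → 𝔸 // ∀ x ∈ U, ∃ K, HasFDerivAt g (mulForm K (fderiv ℝ Z x)) x}
  choose next h0 hd using fun g : T => exists_primitive_mulForm hU hUs hZ hcomm x₀ g.2
  let start : T := ⟨1, fun x _ => ⟨0, by
    have : mulForm (0 : 𝔸) (fderiv ℝ Z x) = 0 := by ext; simp
    rw [this]; exact hasFDerivAt_const _ _⟩⟩
  let G : ℕ → T := fun m => Nat.rec start (fun _ g => ⟨next g, fun x hx => ⟨_, hd g x hx⟩⟩) m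
  exact ⟨fun m => (G m).1, rfl, fun m => h0 (G m), fun m => hd (G m)⟩

namespace IsIteratedPrimitive

variable {U : Set E} {Z : E → 𝔸} {x₀ : E} {G : ℕ → E → 𝔸}

/-- The first iterated primitive is `Z` itself, normalised to vanish at the base point. -/
lemma apply_one (hG : IsIteratedPrimitive U Z x₀ G) (hU : IsOpen U) (hUc : IsPreconnected U)
    (hZ : ContDiffOn ℝ ∞ Z U) (hx₀ : x₀ ∈ U) (hZ0 : Z x₀ = 0) : ∀ x ∈ U, G 1 x = Z x := by
  refine hU.eqOn_of_fderiv_eq (𝕜 := ℝ) hUc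
    (fun x hx => (hG.hasFDerivAt_succ 0 x hx).differentiableAt.differentiableWithinAt)
    (hZ.differentiableOn (by simp)) (fun x hx => ?_) hx₀ (by rw [hG.base, hZ0])
  rw [(hG.hasFDerivAt_succ 0 x hx).fderiv, hG.zero]
  ext v; simp

/-- A homomorphism that multiplies `dZ` by `c` multiplies `G m` by `c ^ m`: both sides are
primitives of the same form. -/
lemma map_eq (hG : IsIteratedPrimitive U Z x₀ G) (hU : IsOpen U) (hUc : IsPreconnected U)
    (hx₀ : x₀ ∈ U) (σ : 𝔸 →+* 𝔸) (hσ : Continuous σ) (c : ℝ)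
    (hc : ∀ x ∈ U, ∀ v, σ (fderiv ℝ Z x v) = c • fderiv ℝ Z x v) (m : ℕ) :
    ∀ x ∈ U, σ (G m x) = c ^ m • G m x := by
  induction m with
  | zero => simp [hG.zero]
  | succ m ih =>
    have hL : ∀ x ∈ U, HasFDerivAt (fun x => σ (G (m + 1) x))
        (((σ : 𝔸 →+ 𝔸).toRealLinearMap hσ).comp (mulForm (G m x) (fderiv ℝ Z x))) x :=
      fun x hx => ((σ : 𝔸 →+ 𝔸).toRealLinearMap hσ).hasFDerivAt.comp x
        (hG.hasFDerivAt_succ m x hx)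
    have hR : ∀ x ∈ U, HasFDerivAt (fun x => c ^ (m + 1) • G (m + 1) x)
        (c ^ (m + 1) • (mulForm (G m x) (fderiv ℝ Z x))) x := fun x hx =>
      (hG.hasFDerivAt_succ m x hx).fun_const_smul _
    refine hU.eqOn_of_fderiv_eq (𝕜 := ℝ) hUc
      (fun x hx => (hL x hx).differentiableAt.differentiableWithinAt)
      (fun x hx => (hR x hx).differentiableAt.differentiableWithinAt) (fun x hx => ?_) hx₀
      (by simp [hG.base])
    rw [(hL x hx).fderiv, (hR x hx).fderiv]
    ext v
    change σ (G m x * fderiv ℝ Z x v) = c ^ (m + 1) • (G m x * fderiv ℝ Z x v)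
    rw [map_mul, ih x hx, hc x hx, smul_mul_smul_comm, pow_succ]

/-- On a small ball summability of `∑ ‖G m‖ R ^ m` spreads from one point to all, uniformly. -/
lemma exists_nhds_summable (hG : IsIteratedPrimitive U Z x₀ G) (hU : IsOpen U)
    (hZ : ContDiffOn ℝ ∞ Z U) {R : ℝ} (hR : 0 ≤ R) {q : E} (hq : q ∈ U) :
    ∃ r > 0, ∃ K, Metric.ball q r ⊆ U ∧ (∀ x ∈ Metric.ball q r, ‖fderiv ℝ Z x‖ ≤ K) ∧
      ∀ x ∈ Metric.ball q r, Summable (fun m => ‖G m x‖ * R ^ m) →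
        ∃ b : ℕ → ℝ, Summable b ∧ ∀ m, ∀ y ∈ Metric.ball q r, ‖G m y‖ * R ^ m ≤ b m := by
  have hcont : ContinuousAt (fun x => ‖fderiv ℝ Z x‖) q :=
    ((hZ.continuousOn_fderiv_of_isOpen hU (by simp)).continuousAt (hU.mem_nhds hq)).norm
  set K := ‖fderiv ℝ Z q‖ + 1 with hKdef
  have hK : 0 < K := by positivity
  have hev : ∀ᶠ x in 𝓝 q, ‖fderiv ℝ Z x‖ < K ∧ x ∈ U :=
    (hcont.eventually (gt_mem_nhds (by simp [K]))).and (hU.mem_nhds hq)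
  obtain ⟨r₀, hr₀, hr₀s⟩ := Metric.eventually_nhds_iff_ball.1 hev
  -- the ball is so small that integrating across it multiplies by at most `1 / (2 (R + 1))`
  set r := min r₀ (1 / (4 * K * (R + 1))) with hrdef
  have hr : 0 < r := lt_min hr₀ (by positivity)
  have hsub : Metric.ball q r ⊆ Metric.ball q r₀ := Metric.ball_subset_ball (min_le_left _ _)
  have hδ : K * (2 * r) * R ≤ 1 / 2 := by
    have h1 : r ≤ 1 / (4 * K * (R + 1)) := min_le_right _ _
    rw [le_div_iff₀ (by positivity)] at h1
    nlinarith [mul_pos hK hr]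
  refine ⟨r, hr, K, fun x hx => (hr₀s x (hsub hx)).2, fun x hx => (hr₀s x (hsub hx)).1.le,
    fun x hx hsum => ?_⟩
  -- `c m` bounds `G m` on the ball, by the mean value inequality from `x`
  let c : ℕ → ℝ := fun m => Nat.rec ‖G 0 x‖ (fun m t => ‖G (m + 1) x‖ + t * K * (2 * r)) m
  have hcs : ∀ m, c (m + 1) = ‖G (m + 1) x‖ + c m * K * (2 * r) := fun m => rfl
  have hc0 : ∀ m, 0 ≤ c m := by
    intro m
    induction m with
    | zero => exact norm_nonneg _
    | succ m ih => rw [hcs]; positivity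
  have hbound : ∀ m, ∀ y ∈ Metric.ball q r, ‖G m y‖ ≤ c m := by
    intro m
    induction m with
    | zero => intro y _; simp [hG.zero, c]
    | succ m ih =>
      intro y hy
      have hdist : ‖y - x‖ ≤ 2 * r := by
        rw [← dist_eq_norm]
        have := dist_triangle_right y x q
        have h1 := Metric.mem_ball.1 hx
        have h2 := Metric.mem_ball.1 hy
        linarith
      have := (convex_ball q r).norm_image_sub_le_of_norm_hasFDerivWithin_le (𝕜 := ℝ)
        (C := c m * K)
        (fun z hz => (hG.hasFDerivAt_succ m z (hr₀s z (hsub hz)).2).hasFDerivWithinAt)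
        (fun z hz => (norm_mulForm_le _ _).trans
          (mul_le_mul (ih z hz) (hr₀s z (hsub hz)).1.le (norm_nonneg _) (hc0 m))) hx hy
      rw [hcs]
      calc ‖G (m + 1) y‖ ≤ ‖G (m + 1) x‖ + ‖G (m + 1) y - G (m + 1) x‖ := by
            simpa using norm_add_le (G (m + 1) x) (G (m + 1) y - G (m + 1) x)
        _ ≤ _ := by
            gcongr
            exact this.trans (by gcongr; exact mul_nonneg (hc0 m) hK.le)
  refine ⟨fun m => c m * R ^ m, ?_, fun m y hy =>
    mul_le_mul_of_nonneg_right (hbound m y hy) (by positivity)⟩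
  set A := ∑' m, ‖G m x‖ * R ^ m
  have hnn : ∀ m, 0 ≤ ‖G m x‖ * R ^ m := fun m => by positivity
  refine summable_of_sum_range_le (c := 2 * A) (fun m => mul_nonneg (hc0 m) (by positivity)) ?_
  intro N
  induction N with
  | zero => simpa using mul_nonneg zero_le_two (tsum_nonneg hnn)
  | succ N ih =>
    -- each term is at most the term at `x` plus half of its predecessor
    have hstep : ∀ m, c (m + 1) * R ^ (m + 1) ≤
        ‖G (m + 1) x‖ * R ^ (m + 1) + 1 / 2 * (c m * R ^ m) := by
      intro m
      have h0 : 0 ≤ c m * R ^ m := mul_nonneg (hc0 m) (by positivity)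
      calc c (m + 1) * R ^ (m + 1)
          = ‖G (m + 1) x‖ * R ^ (m + 1) + K * (2 * r) * R * (c m * R ^ m) := by
            rw [hcs]; ring
        _ ≤ _ := by gcongr
    have hpart : ∑ m ∈ Finset.range (N + 1), ‖G m x‖ * R ^ m ≤ A :=
      hsum.sum_le_tsum _ fun m _ => hnn m
    rw [Finset.sum_range_succ'] at hpart ⊢
    have := Finset.sum_le_sum fun m (_ : m ∈ Finset.range N) => hstep m
    rw [Finset.sum_add_distrib, ← Finset.mul_sum] at this
    have hz : c 0 = ‖G 0 x‖ := rfl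
    rw [hz]
    linarith

/-- The series `∑ z ^ m G m` converges normally near every point of `U`. -/
lemma exists_ball_summable (hG : IsIteratedPrimitive U Z x₀ G) (hU : IsOpen U)
    (hUc : IsPreconnected U) (hZ : ContDiffOn ℝ ∞ Z U) (hx₀ : x₀ ∈ U) {R : ℝ} (hR : 0 ≤ R) {q : E}
    (hq : q ∈ U) :
    ∃ r > 0, ∃ K, Metric.ball q r ⊆ U ∧ (∀ x ∈ Metric.ball q r, ‖fderiv ℝ Z x‖ ≤ K) ∧
        ∃ b : ℕ → ℝ, Summable b ∧ ∀ m, ∀ y ∈ Metric.ball q r, ‖G m y‖ * R ^ m ≤ b m := by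
  have hsum : Summable (fun m => ‖G m q‖ * R ^ m) := by
    have hstart : Summable (fun m => ‖G m x₀‖ * R ^ m) :=
      summable_of_ne_finset_zero (s := {0}) fun m hm => by
        obtain ⟨m, rfl⟩ := Nat.exists_eq_succ_of_ne_zero (by simpa using hm)
        simp [hG.base]
    -- summability holds at `x₀`, where only `G 0` survives, and propagates along `U`
    refine hUc.induction₂' (fun x y => Summable (fun m => ‖G m x‖ * R ^ m) →
      Summable (fun m => ‖G m y‖ * R ^ m)) (fun x hx => ?_) (fun x y z _ _ _ h1 h2 => h2 ∘ h1)
      hx₀ hq hstart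
    obtain ⟨r, hr, K, -, -, h⟩ := hG.exists_nhds_summable hU hZ hR hx
    have hspread : ∀ y ∈ Metric.ball x r, ∀ z ∈ Metric.ball x r,
        Summable (fun m => ‖G m y‖ * R ^ m) → Summable (fun m => ‖G m z‖ * R ^ m) := by
      intro y hy z hz hs
      obtain ⟨b, hb, hbs⟩ := h y hy hs
      exact hb.of_nonneg_of_le (fun m => by positivity) fun m => hbs m z hz
    filter_upwards [mem_nhdsWithin_of_mem_nhds (Metric.ball_mem_nhds x hr)] with y hy
    exact ⟨hspread x (Metric.mem_ball_self hr) y hy, hspread y hy x (Metric.mem_ball_self hr)⟩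
  obtain ⟨r, hr, K, h1, h2, h3⟩ := hG.exists_nhds_summable hU hZ hR hq
  exact ⟨r, hr, K, h1, h2, h3 q (Metric.mem_ball_self hr) hsum⟩

end IsIteratedPrimitive

end Series

/-! ### The generating series of the iterated primitives -/

section Sum

variable {E 𝔸 : Type*} [NormedAddCommGroup E] [NormedSpace ℝ E] [NormedRing 𝔸]
  [NormedAlgebra ℂ 𝔸]

/-- The generating series `∑ z ^ m G m`. -/
noncomputable def genSeries (G : ℕ → E → 𝔸) (z : ℂ) (x : E) : 𝔸 := ∑' m, z ^ m • G m x

lemma norm_pow_smul_le {X : Type*} (G : ℕ → X → 𝔸) {z : ℂ} {R : ℝ} (hz : ‖z‖ ≤ R) (m : ℕ) (x : X) :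
    ‖z ^ m • G m x‖ ≤ ‖G m x‖ * R ^ m := by
  rw [norm_smul, norm_pow, mul_comm]
  gcongr

namespace IsIteratedPrimitive

variable {U : Set E} {Z : E → 𝔸} {x₀ : E} {G : ℕ → E → 𝔸}

lemma genSeries_base (hG : IsIteratedPrimitive U Z x₀ G) (z : ℂ) : genSeries G z x₀ = 1 := by
  rw [genSeries, tsum_eq_single 0]
  · simp [hG.zero]
  · intro m hm
    obtain ⟨m, rfl⟩ := Nat.exists_eq_succ_of_ne_zero hm
    simp [hG.base]

lemma summable_norm (hG : IsIteratedPrimitive U Z x₀ G) (hU : IsOpen U)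
    (hUc : IsPreconnected U) (hZ : ContDiffOn ℝ ∞ Z U) (hx₀ : x₀ ∈ U) {R : ℝ} (hR : 0 ≤ R) {x : E}
    (hx : x ∈ U) : Summable fun m => ‖G m x‖ * R ^ m := by
  obtain ⟨r, hr, -, -, -, b, hb, hbs⟩ := hG.exists_ball_summable hU hUc hZ hx₀ hR hx
  exact hb.of_nonneg_of_le (fun m => by positivity) fun m => hbs m x (Metric.mem_ball_self hr)

variable [CompleteSpace 𝔸]

lemma summable (hG : IsIteratedPrimitive U Z x₀ G) (hU : IsOpen U)
    (hUc : IsPreconnected U) (hZ : ContDiffOn ℝ ∞ Z U) (hx₀ : x₀ ∈ U) (z : ℂ) {x : E}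
    (hx : x ∈ U) : Summable fun m => z ^ m • G m x :=
  .of_norm_bounded (hG.summable_norm hU hUc hZ hx₀ (norm_nonneg z) hx)
    fun m => norm_pow_smul_le G le_rfl m x

lemma differentiable_genSeries (hG : IsIteratedPrimitive U Z x₀ G) (hU : IsOpen U)
    (hUc : IsPreconnected U) (hZ : ContDiffOn ℝ ∞ Z U) (hx₀ : x₀ ∈ U) {x : E} (hx : x ∈ U) :
    Differentiable ℂ fun z => genSeries G z x := by
  intro z
  have hz : z ∈ Metric.ball (0 : ℂ) (‖z‖ + 1) := by simp
  refine ((Complex.differentiableOn_tsum_of_summable_norm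
    (hG.summable_norm hU hUc hZ hx₀ (R := ‖z‖ + 1) (by positivity) hx)
    (fun m => ((differentiable_id.pow m).smul_const (G m x)).differentiableOn)
    Metric.isOpen_ball fun m w hw => norm_pow_smul_le G ?_ m x)).differentiableAt
      (Metric.isOpen_ball.mem_nhds hz)
  simpa using (Metric.mem_ball.1 hw).le

lemma deriv_genSeries_zero (hG : IsIteratedPrimitive U Z x₀ G) (hU : IsOpen U)
    (hUc : IsPreconnected U) (hZ : ContDiffOn ℝ ∞ Z U) (hx₀ : x₀ ∈ U) {x : E} (hx : x ∈ U) :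
    deriv (fun z => genSeries G z x) 0 = G 1 x := by
  have hd : ∀ m, deriv (fun z : ℂ => z ^ m • G m x) 0 = ((m : ℂ) * 0 ^ (m - 1)) • G m x := by
    intro m
    exact ((hasDerivAt_pow m (0 : ℂ)).smul_const (G m x)).deriv
  have h := Complex.hasSum_deriv_of_summable_norm
    (hG.summable_norm hU hUc hZ hx₀ (R := 1) zero_le_one hx)
    (fun m => ((differentiable_id.pow m).smul_const (G m x)).differentiableOn)
    (Metric.isOpen_ball (x := (0 : ℂ)) (ε := 1))
    (fun m w hw => norm_pow_smul_le G (by simpa using (Metric.mem_ball.1 hw).le) m x)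
    (Metric.mem_ball_self one_pos)
  refine h.unique ?_
  simp only [Pi.pow_apply, id_eq, hd]
  convert! hasSum_single (f := fun m : ℕ => ((m : ℂ) * 0 ^ (m - 1)) • G m x) 1 ?_ using 1
  · simp
  · rintro m hm
    rcases m with _ | _ | m
    · simp
    · simp at hm
    · simp

/-- `dG_z = z G_z dZ`. -/
lemma hasFDerivAt_genSeries (hG : IsIteratedPrimitive U Z x₀ G)
    (hU : IsOpen U) (hUc : IsPreconnected U) (hZ : ContDiffOn ℝ ∞ Z U) (hx₀ : x₀ ∈ U) (z : ℂ)
    {x : E} (hx : x ∈ U) :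
    HasFDerivAt (genSeries G z) (mulForm (z • genSeries G z x) (fderiv ℝ Z x)) x := by
  obtain ⟨r, hr, K, hrU, hK, b, hb, hbs⟩ :=
    hG.exists_ball_summable hU hUc hZ hx₀ (norm_nonneg z) hx
  have hxr := Metric.mem_ball_self (x := x) hr
  have hterm : ∀ m, ∀ y ∈ Metric.ball x r, HasFDerivAt (fun y => z ^ (m + 1) • G (m + 1) y)
      (mulForm (z ^ (m + 1) • G m y) (fderiv ℝ Z y)) y := by
    intro m y hy
    refine ((hG.hasFDerivAt_succ m y (hrU hy)).fun_const_smul (z ^ (m + 1))).congr_fderiv ?_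
    ext v
    simp
  have hK0 : 0 ≤ K := (norm_nonneg _).trans (hK x hxr)
  have hb' : Summable fun m => ‖z‖ * b m * K := (hb.mul_left _).mul_right _
  have h := hasFDerivAt_tsum_of_isPreconnected hb' Metric.isOpen_ball
    (convex_ball x r).isPreconnected hterm (fun m y hy => by
      refine (norm_mulForm_le _ _).trans ?_
      refine mul_le_mul ?_ (hK y hy) (norm_nonneg _) ?_
      · rw [pow_succ', mul_smul, norm_smul]
        gcongr
        exact (norm_pow_smul_le G le_rfl m y).trans (hbs m y hy)
      · exact mul_nonneg (norm_nonneg z) (le_trans (by positivity) (hbs m y hy))) hxr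
    ((summable_nat_add_iff 1).2 (hG.summable hU hUc hZ hx₀ z hx)) hxr
  have hval : (∑' m, mulForm (z ^ (m + 1) • G m x) (fderiv ℝ Z x)) =
      mulForm (z • genSeries G z x) (fderiv ℝ Z x) := by
    have hs : HasSum (fun m => z ^ (m + 1) • G m x) (z • genSeries G z x) := by
      simp only [pow_succ', mul_smul]
      exact (hG.summable hU hUc hZ hx₀ z hx).hasSum.const_smul z
    exact ((((ContinuousLinearMap.compL ℝ E 𝔸 𝔸).flip (fderiv ℝ Z x)).comp
      (ContinuousLinearMap.mul ℝ 𝔸)).hasSum hs).tsum_eq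
  rw [hval] at h
  refine (h.const_add 1).congr_of_eventuallyEq ?_
  filter_upwards [Metric.isOpen_ball.mem_nhds hxr] with y hy
  rw [genSeries, (hG.summable hU hUc hZ hx₀ z (hrU hy)).tsum_eq_zero_add]
  simp [hG.zero]

/-- `G_z` is smooth, by bootstrapping the equation `dG_z = z G_z dZ`. -/
lemma contDiffOn_genSeries (hG : IsIteratedPrimitive U Z x₀ G)
    (hU : IsOpen U) (hUc : IsPreconnected U) (hZ : ContDiffOn ℝ ∞ Z U) (hx₀ : x₀ ∈ U) (z : ℂ) :
    ContDiffOn ℝ ∞ (genSeries G z) U := by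
  have hd := fun x (hx : x ∈ U) => hG.hasFDerivAt_genSeries hU hUc hZ hx₀ z hx
  have hdiff : DifferentiableOn ℝ (genSeries G z) U :=
    fun x hx => (hd x hx).differentiableAt.differentiableWithinAt
  have hZ' : ContDiffOn ℝ ∞ (fderiv ℝ Z) U :=
    ((contDiffOn_infty_iff_fderiv_of_isOpen hU).1 hZ).2
  rw [contDiffOn_infty]
  intro k
  induction k with
  | zero => exact contDiffOn_zero.2 hdiff.continuousOn
  | succ k ih =>
    rw [Nat.cast_succ, contDiffOn_succ_iff_fderiv_of_isOpen hU]
    refine ⟨hdiff, fun h => absurd h (WithTop.coe_ne_top (a := (k : ℕ∞))), ?_⟩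
    refine ContDiffOn.congr (f := fun x => mulForm (z • genSeries G z x) (fderiv ℝ Z x)) ?_
      fun x hx => (hd x hx).fderiv
    exact ((ContinuousLinearMap.mul ℝ 𝔸).contDiff.comp_contDiffOn (ih.const_smul z)).clm_comp
      (hZ'.of_le (by exact_mod_cast le_top))

/-- A homomorphism `σ` that multiplies `dZ` by `c` carries `G_w` to `G_z` if it turns the scalar
`w` into `w'` with `w' c = z`. -/
lemma map_genSeries (hG : IsIteratedPrimitive U Z x₀ G)
    (hU : IsOpen U) (hUc : IsPreconnected U) (hZ : ContDiffOn ℝ ∞ Z U) (hx₀ : x₀ ∈ U)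
    (σ : 𝔸 →+* 𝔸) (hσc : Continuous σ) (c : ℝ)
    (hc : ∀ x ∈ U, ∀ v, σ (fderiv ℝ Z x v) = c • fderiv ℝ Z x v) {w w' z : ℂ}
    (hσ : ∀ a, σ (w • a) = w' • σ a) (hz : w' * c = z) {x : E} (hx : x ∈ U) :
    σ (genSeries G w x) = genSeries G z x := by
  have hpow : ∀ (m : ℕ) a, σ (w ^ m • a) = w' ^ m • σ a := by
    intro m
    induction m with
    | zero => simp
    | succ m ih => intro a; rw [pow_succ, mul_smul, ih, hσ, ← mul_smul, ← pow_succ]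
  rw [genSeries, genSeries]
  refine (((σ : 𝔸 →+ 𝔸).toRealLinearMap hσc).map_tsum (hG.summable hU hUc hZ hx₀ w hx)).trans ?_
  congr 1 with m
  change σ (w ^ m • G m x) = _
  rw [hpow, hG.map_eq hU hUc hx₀ σ hσc c hc m x hx, ← hz, mul_pow, mul_smul,
    ← Complex.coe_smul]
  simp

end IsIteratedPrimitive

end Sum

/-! ### Partial derivatives of vector- and matrix-valued maps -/

section Calculus

variable {n : ℕ} {U : Set (Fin n → ℝ)}

section Vector

variable {V : Type*} [NormedAddCommGroup V] [NormedSpace ℝ V]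

lemma contDiffOn_pd (hU : IsOpen U) {g : (Fin n → ℝ) → V} (hg : ContDiffOn ℝ ∞ g U) (i : Fin n) :
    ContDiffOn ℝ ∞ (pd i g) U :=
  ((contDiffOn_infty_iff_fderiv_of_isOpen hU).1 hg).2.clm_apply contDiffOn_const

lemma differentiableAt_of_contDiffOn (hU : IsOpen U) {g : (Fin n → ℝ) → V}
    (hg : ContDiffOn ℝ ∞ g U) {x : Fin n → ℝ} (hx : x ∈ U) : DifferentiableAt ℝ g x :=
  (hg.contDiffAt (hU.mem_nhds hx)).differentiableAt (by simp)

lemma pd_congr (hU : IsOpen U) {g h : (Fin n → ℝ) → V} (hgh : ∀ x ∈ U, g x = h x)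
    {x : Fin n → ℝ} (hx : x ∈ U) (i : Fin n) : pd i g x = pd i h x := by
  have : g =ᶠ[𝓝 x] h := by filter_upwards [hU.mem_nhds hx] with y hy using hgh y hy
  rw [pd, pd, this.fderiv_eq]

lemma pd_pd_comm (hU : IsOpen U) {g : (Fin n → ℝ) → V} (hg : ContDiffOn ℝ ∞ g U)
    {x : Fin n → ℝ} (hx : x ∈ U) (i j : Fin n) : pd i (pd j g) x = pd j (pd i g) x := by
  have hgx : ContDiffAt ℝ ∞ g x := hg.contDiffAt (hU.mem_nhds hx)
  have h2 : DifferentiableAt ℝ (fderiv ℝ g) x :=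
    differentiableAt_of_contDiffOn hU ((contDiffOn_infty_iff_fderiv_of_isOpen hU).1 hg).2 hx
  have key : ∀ i j, pd i (pd j g) x = fderiv ℝ (fderiv ℝ g) x (Pi.single i 1) (Pi.single j 1) := by
    intro i j
    change fderiv ℝ (fun y => fderiv ℝ g y (Pi.single j 1)) x (Pi.single i 1) = _
    rw [fderiv_clm_apply h2 (differentiableAt_const _)]
    simp
  rw [key, key]
  exact (hgx.isSymmSndFDerivAt (by simpa using two_le_infty)) _ _

lemma pd_clm_comp {W : Type*} [NormedAddCommGroup W] [NormedSpace ℝ W] (L : V →L[ℝ] W)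
    {g : (Fin n → ℝ) → V} {x : Fin n → ℝ} (hg : DifferentiableAt ℝ g x) (i : Fin n) :
    pd i (fun y => L (g y)) x = L (pd i g x) := by
  change fderiv ℝ (L ∘ g) x _ = _
  rw [(L.hasFDerivAt.comp x hg.hasFDerivAt).fderiv]
  rfl

@[simp] lemma pd_const (i : Fin n) (c : V) (x : Fin n → ℝ) : pd i (fun _ => c) x = 0 := by
  simp [pd]

lemma pd_sum {ι : Type*} (s : Finset ι) {g : ι → (Fin n → ℝ) → V} {x : Fin n → ℝ}
    (hg : ∀ a ∈ s, DifferentiableAt ℝ (g a) x) (i : Fin n) :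
    pd i (fun y => ∑ a ∈ s, g a y) x = ∑ a ∈ s, pd i (g a) x := by
  simp [pd, fderiv_fun_sum hg]

lemma fderiv_eq_sum_pd (g : (Fin n → ℝ) → V) (x v : Fin n → ℝ) :
    fderiv ℝ g x v = ∑ i, v i • pd i g x := by
  conv_lhs => rw [pi_eq_sum_univ' v]
  simp [pd, map_sum]

end Vector

section Algebra

variable {𝕂 : Type*} [NormedCommRing 𝕂] [NormedAlgebra ℝ 𝕂]

lemma pd_mul {g h : (Fin n → ℝ) → 𝕂} {x : Fin n → ℝ} (hg : DifferentiableAt ℝ g x)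
    (hh : DifferentiableAt ℝ h x) (i : Fin n) :
    pd i (fun y => g y * h y) x = pd i g x * h x + g x * pd i h x := by
  simp only [pd, fderiv_fun_mul hg hh]
  simp
  ring

/-- All entries of the matrix-valued map `M` are smooth on `U`. Stating smoothness entrywise avoids
the choice of a norm on matrices. -/
def MatSmooth {ι κ V : Type*} [NormedAddCommGroup V] [NormedSpace ℝ V] (U : Set (Fin n → ℝ))
    (M : (Fin n → ℝ) → Matrix ι κ V) : Prop :=
  ∀ a b, ContDiffOn ℝ ∞ (fun x => M x a b) U

variable {ι κ μ : Type*} {M : (Fin n → ℝ) → Matrix ι κ 𝕂} {N : (Fin n → ℝ) → Matrix κ μ 𝕂}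

lemma MatSmooth.const (c : Matrix ι κ 𝕂) : MatSmooth U fun _ => c := fun _ _ => contDiffOn_const

lemma MatSmooth.transpose (hM : MatSmooth U M) : MatSmooth U fun x => (M x)ᵀ := fun a b => hM b a

lemma MatSmooth.neg (hM : MatSmooth U M) : MatSmooth U fun x => -M x := fun a b => (hM a b).neg

lemma MatSmooth.sub {M' : (Fin n → ℝ) → Matrix ι κ 𝕂} (hM : MatSmooth U M) (hM' : MatSmooth U M') :
    MatSmooth U fun x => M x - M' x := fun a b => (hM a b).sub (hM' a b)

lemma MatSmooth.mul [Fintype κ] (hM : MatSmooth U M) (hN : MatSmooth U N) :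
    MatSmooth U fun x => M x * N x := by
  intro a b
  simp only [Matrix.mul_apply]
  exact ContDiffOn.sum fun c _ => (hM a c).mul (hN c b)

lemma MatSmooth.matPd (hU : IsOpen U) (hM : MatSmooth U M) (i : Fin n) :
    MatSmooth U (matPd i M) := fun a b => contDiffOn_pd hU (hM a b) i

lemma MatSmooth.fromBlocks {ι' κ' : Type*} {A : (Fin n → ℝ) → Matrix ι κ 𝕂}
    {B : (Fin n → ℝ) → Matrix ι κ' 𝕂} {C : (Fin n → ℝ) → Matrix ι' κ 𝕂}
    {D : (Fin n → ℝ) → Matrix ι' κ' 𝕂} (hA : MatSmooth U A) (hB : MatSmooth U B)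
    (hC : MatSmooth U C) (hD : MatSmooth U D) :
    MatSmooth U fun x => Matrix.fromBlocks (A x) (B x) (C x) (D x) := by
  rintro (a | a) (b | b)
  exacts [hA a b, hB a b, hC a b, hD a b]

lemma MatSmooth.map_ofReal {M : (Fin n → ℝ) → Matrix ι κ ℝ} (hM : MatSmooth U M) :
    MatSmooth U fun x => (M x).map Complex.ofReal :=
  fun a b => Complex.ofRealCLM.contDiff.comp_contDiffOn (hM a b)

lemma matPd_congr (hU : IsOpen U) {M' : (Fin n → ℝ) → Matrix ι κ 𝕂} (h : ∀ x ∈ U, M x = M' x)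
    {x : Fin n → ℝ} (hx : x ∈ U) (i : Fin n) : matPd i M x = matPd i M' x := by
  ext a b
  exact pd_congr hU (fun y hy => by rw [h y hy]) hx i

lemma matPd_mul [Fintype κ] (hU : IsOpen U) (hM : MatSmooth U M) (hN : MatSmooth U N)
    {x : Fin n → ℝ} (hx : x ∈ U) (i : Fin n) :
    matPd i (fun y => M y * N y) x = matPd i M x * N x + M x * matPd i N x := by
  have hM' := fun a b => differentiableAt_of_contDiffOn hU (hM a b) hx
  have hN' := fun a b => differentiableAt_of_contDiffOn hU (hN a b) hx
  ext a b
  simp only [matPd, Matrix.of_apply, Matrix.add_apply, Matrix.mul_apply]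
  rw [pd_sum _ fun c _ => (hM' a c).fun_mul (hN' c b), ← Finset.sum_add_distrib]
  exact Finset.sum_congr rfl fun c _ => pd_mul (hM' a c) (hN' c b) i

@[simp] lemma matPd_const (i : Fin n) (c : Matrix ι κ 𝕂) (x : Fin n → ℝ) :
    matPd i (fun _ => c) x = 0 := by
  ext a b; simp [matPd]

lemma matPd_mul_const [Fintype κ] (hU : IsOpen U) (hM : MatSmooth U M) (c : Matrix κ μ 𝕂)
    {x : Fin n → ℝ} (hx : x ∈ U) (i : Fin n) :
    matPd i (fun y => M y * c) x = matPd i M x * c := by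
  rw [matPd_mul hU hM (.const c) hx, matPd_const, Matrix.mul_zero, add_zero]

lemma matPd_const_mul [Fintype κ] (hU : IsOpen U) (c : Matrix ι κ 𝕂) (hN : MatSmooth U N)
    {x : Fin n → ℝ} (hx : x ∈ U) (i : Fin n) :
    matPd i (fun y => c * N y) x = c * matPd i N x := by
  rw [matPd_mul hU (.const c) hN hx, matPd_const, Matrix.zero_mul, zero_add]

lemma matPd_transpose (i : Fin n) (x : Fin n → ℝ) :
    matPd i (fun y => (M y)ᵀ) x = (matPd i M x)ᵀ := rfl

lemma matPd_neg (i : Fin n) (x : Fin n → ℝ) : matPd i (fun y => -M y) x = -matPd i M x := by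
  ext a b
  simp [matPd, pd]

lemma matPd_sub {M' : (Fin n → ℝ) → Matrix ι κ 𝕂} (hU : IsOpen U) (hM : MatSmooth U M)
    (hM' : MatSmooth U M') {x : Fin n → ℝ} (hx : x ∈ U) (i : Fin n) :
    matPd i (fun y => M y - M' y) x = matPd i M x - matPd i M' x := by
  ext a b
  simp [matPd, pd, fderiv_fun_sub (differentiableAt_of_contDiffOn hU (hM a b) hx)
    (differentiableAt_of_contDiffOn hU (hM' a b) hx)]

lemma matPd_fromBlocks {ι' κ' : Type*} (A : (Fin n → ℝ) → Matrix ι κ 𝕂)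
    (B : (Fin n → ℝ) → Matrix ι κ' 𝕂) (C : (Fin n → ℝ) → Matrix ι' κ 𝕂)
    (D : (Fin n → ℝ) → Matrix ι' κ' 𝕂) (i : Fin n) (x : Fin n → ℝ) :
    matPd i (fun y => Matrix.fromBlocks (A y) (B y) (C y) (D y)) x =
      Matrix.fromBlocks (matPd i A x) (matPd i B x) (matPd i C x) (matPd i D x) := by
  ext (a | a) (b | b) <;> rfl

lemma matPd_map_ofReal {M : (Fin n → ℝ) → Matrix ι κ ℝ} (hU : IsOpen U) (hM : MatSmooth U M)
    {x : Fin n → ℝ} (hx : x ∈ U) (i : Fin n) :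
    matPd i (fun y => (M y).map Complex.ofReal) x = (matPd i M x).map Complex.ofReal := by
  ext a b
  exact pd_clm_comp Complex.ofRealCLM (differentiableAt_of_contDiffOn hU (hM a b) hx) i

lemma matPd_matPd_comm (hU : IsOpen U) (hM : MatSmooth U M) {x : Fin n → ℝ} (hx : x ∈ U)
    (i j : Fin n) : matPd i (matPd j M) x = matPd j (matPd i M) x := by
  ext a b
  exact pd_pd_comm hU (hM a b) hx i j

lemma eq_of_matPd_eq_zero (hU : IsOpen U) (hUc : IsPreconnected U) (hM : MatSmooth U M)
    (h : ∀ x ∈ U, ∀ i, matPd i M x = 0) {x y : Fin n → ℝ} (hx : x ∈ U) (hy : y ∈ U) :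
    M x = M y := by
  ext a b
  refine hU.is_const_of_fderiv_eq_zero (𝕜 := ℝ) (f := fun x => M x a b) hUc
    ((hM a b).differentiableOn (by simp)) (fun z hz => ?_) hx hy
  ext v
  rw [fderiv_eq_sum_pd]
  exact Finset.sum_eq_zero fun i _ => by
    rw [show pd i (fun x => M x a b) z = matPd i M z a b from rfl, h z hz]
    simp

end Algebra

end Calculus

/-! ### The common frame of a Combescure sequence -/

section Frame

lemma eps_mul_self (n k : ℕ) (i : Fin n) : eps n k i * eps n k i = 1 := by
  unfold eps; split_ifs <;> simp

lemma J_mul_J (n k : ℕ) : J n k * J n k = 1 := by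
  rw [J, Matrix.diagonal_mul_diagonal]
  simp [eps_mul_self]

lemma J_transpose (n k : ℕ) : (J n k)ᵀ = J n k := Matrix.diagonal_transpose _

/-- The matrix with rows `e₁, …, eₙ, t`. -/
def rowMat {n : ℕ} (e : Fin n → Fin (n + 1) → ℝ) (t : Fin (n + 1) → ℝ) :
    Matrix (Fin (n + 1)) (Fin (n + 1)) ℝ := Matrix.of (Fin.snoc e t)

lemma rowMat_last {n : ℕ} (e : Fin n → Fin (n + 1) → ℝ) (t : Fin (n + 1) → ℝ) :
    rowMat e t (Fin.last n) = t := funext fun a => by simp [rowMat]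

lemma rowMat_castSucc {n : ℕ} (e : Fin n → Fin (n + 1) → ℝ) (t : Fin (n + 1) → ℝ) (i : Fin n) :
    rowMat e t i.castSucc = e i := funext fun a => by simp [rowMat]

/-- The generalised cross product of `e₁, …, eₙ`: its inner product with `t` is the determinant
of `rowMat e t`. -/
def crossVec {n : ℕ} (e : Fin n → Fin (n + 1) → ℝ) (a : Fin (n + 1)) : ℝ :=
  (rowMat e (Pi.single a 1)).det

/-- `n` orthonormal vectors in `ℝⁿ⁺¹` are the first rows of an orthogonal matrix. -/
lemma exists_completion {n : ℕ} {e : Fin n → Fin (n + 1) → ℝ}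
    (he : ∀ i j, e i ⬝ᵥ e j = if i = j then 1 else 0) :
    ∃ t, rowMat e t * (rowMat e t)ᵀ = 1 := by
  let v : Fin (n + 1) → EuclideanSpace ℝ (Fin (n + 1)) :=
    Fin.snoc (fun i => WithLp.toLp 2 (e i)) 0
  have hv : ∀ i : Fin n, v i.castSucc = WithLp.toLp 2 (e i) := fun i => by simp [v]
  have hon : Orthonormal ℝ ((Set.range (Fin.castSucc : Fin n → Fin (n + 1))).domRestrict v) := by
    rw [orthonormal_iff_ite]
    rintro ⟨_, i, rfl⟩ ⟨_, j, rfl⟩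
    have hij : (⟨i.castSucc, i, rfl⟩ : Set.range (Fin.castSucc : Fin n → Fin (n + 1))) =
        ⟨j.castSucc, j, rfl⟩ ↔ i = j :=
      Subtype.mk_eq_mk.trans Fin.castSucc_inj
    simp only [Set.domRestrict_apply, hv, hij]
    rw [EuclideanSpace.inner_toLp_toLp, ← he, dotProduct_comm, star_trivial]
  obtain ⟨b, hb⟩ := hon.exists_orthonormalBasis_extension_of_card_eq (by simp)
  refine ⟨(b (Fin.last n)).ofLp, ?_⟩
  have hrow : ∀ p, rowMat e (b (Fin.last n)).ofLp p = (b p).ofLp := by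
    intro p
    refine Fin.lastCases ?_ (fun i => ?_) p
    · rw [rowMat_last]
    · rw [hb _ ⟨i, rfl⟩, hv, rowMat_castSucc]
  ext p q
  have := orthonormal_iff_ite.1 b.orthonormal q p
  rw [EuclideanSpace.inner_eq_star_dotProduct] at this
  simp only [star_trivial] at this
  rw [Matrix.mul_apply', Matrix.one_apply]
  change rowMat e _ p ⬝ᵥ rowMat e _ q = _
  rw [hrow, hrow, this]
  simp [eq_comm]

/-- The cross product of an orthonormal family completes it to an orthonormal basis: it is
`± t` for the last row `t` of any orthogonal completion. Unlike `t` itself it depends smoothly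
on the family. -/
lemma crossVec_orthonormal {n : ℕ} {e : Fin n → Fin (n + 1) → ℝ}
    (he : ∀ i j, e i ⬝ᵥ e j = if i = j then 1 else 0) :
    crossVec e ⬝ᵥ crossVec e = 1 ∧ ∀ i, e i ⬝ᵥ crossVec e = 0 := by
  obtain ⟨t, ht⟩ := exists_completion he
  set M := rowMat e t
  have hupd : ∀ a, rowMat e (Pi.single a 1) = M.updateRow (Fin.last n) (Pi.single a 1) := by
    intro a
    ext p q
    refine Fin.lastCases ?_ (fun i => ?_) p
    · simp [rowMat]
    · simp [rowMat, M]
  -- the entries of `crossVec e` are the cofactors of the last row of `M`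
  have hadj : M.adjugate = M.det • Mᵀ := by
    calc M.adjugate = M.adjugate * (M * Mᵀ) := by rw [ht, Matrix.mul_one]
      _ = _ := by rw [← Matrix.mul_assoc, Matrix.adjugate_mul]; simp
  have hN : ∀ a, crossVec e a = M.det * t a := by
    intro a
    rw [crossVec, hupd, ← Matrix.adjugate_apply, hadj]
    simp [M, rowMat]
  have hdet : M.det * M.det = 1 := by
    have := congrArg Matrix.det ht
    rwa [Matrix.det_mul, Matrix.det_transpose, Matrix.det_one] at this
  have hN' : crossVec e = M.det • t := funext hN
  have hrow : ∀ p q, M p ⬝ᵥ M q = (1 : Matrix _ _ ℝ) p q := fun p q => congrFun (congrFun ht p) q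
  have hlast : M (Fin.last n) = t := rowMat_last e t
  have hcast : ∀ i : Fin n, M i.castSucc = e i := rowMat_castSucc e t
  constructor
  · rw [hN', smul_dotProduct, dotProduct_smul, ← hlast, hrow]
    simp [hdet]
  · intro i
    rw [hN', dotProduct_smul, ← hlast, ← hcast, hrow,
      Matrix.one_apply_ne (Fin.castSucc_lt_last i).ne]
    simp

lemma contDiffOn_crossVec {n : ℕ} {X : Type*} [NormedAddCommGroup X] [NormedSpace ℝ X] {U : Set X}
    {e : X → Fin n → Fin (n + 1) → ℝ} (he : ∀ i a, ContDiffOn ℝ ∞ (fun x => e x i a) U)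
    (a : Fin (n + 1)) : ContDiffOn ℝ ∞ (fun x => crossVec (e x) a) U := by
  simp only [crossVec, Matrix.det_apply]
  refine ContDiffOn.sum fun σ _ => ContDiffOn.const_smul _ (contDiffOn_prod fun p _ => ?_)
  generalize σ p = q
  refine Fin.lastCases ?_ (fun i => ?_) q
  · simpa [rowMat] using contDiffOn_const
  · simpa [rowMat] using he i p

/-- The matrix with columns `e₁, …, eₙ, N`, where `N` is the cross product of the `eᵢ`. -/
def frameMat {n : ℕ} (e : Fin n → Fin (n + 1) → ℝ) : Matrix (Fin (n + 1)) (Fin (n + 1)) ℝ :=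
  (rowMat e (crossVec e))ᵀ

lemma frameMat_castSucc {n : ℕ} (e : Fin n → Fin (n + 1) → ℝ) (a : Fin (n + 1)) (i : Fin n) :
    frameMat e a i.castSucc = e i a := by simp [frameMat, rowMat]

lemma frameMat_last {n : ℕ} (e : Fin n → Fin (n + 1) → ℝ) (a : Fin (n + 1)) :
    frameMat e a (Fin.last n) = crossVec e a := by simp [frameMat, rowMat]

lemma frameMat_transpose_mul_self {n : ℕ} {e : Fin n → Fin (n + 1) → ℝ}
    (he : ∀ i j, e i ⬝ᵥ e j = if i = j then 1 else 0) : (frameMat e)ᵀ * frameMat e = 1 := by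
  obtain ⟨h1, h2⟩ := crossVec_orthonormal he
  have hr := rowMat_last e (crossVec e)
  have hc := rowMat_castSucc e (crossVec e)
  ext p q
  rw [frameMat, Matrix.transpose_transpose, Matrix.mul_apply']
  change rowMat e (crossVec e) p ⬝ᵥ rowMat e (crossVec e) q = _
  refine Fin.lastCases ?_ (fun i => ?_) p <;> refine Fin.lastCases ?_ (fun j => ?_) q
  · rw [hr, h1]; simp
  · rw [hr, hc, dotProduct_comm, h2, Matrix.one_apply_ne (Fin.castSucc_lt_last j).ne']
  · rw [hr, hc, h2, Matrix.one_apply_ne (Fin.castSucc_lt_last i).ne]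
  · rw [hc, hc, he]; simp [Matrix.one_apply]

/-- `g` is a smooth orthonormal frame on `U` whose first `n` columns are the principal directions
common to all `f l` (the last one is then a unit normal), and the entry `W x i l`
is the nonvanishing factor of the `i`-th principal direction in `∂ᵢ(f l)`, that is, the `i`-th
component of the metric field of `f l`. -/
structure IsFrame {n : ℕ} (U : Set (Fin n → ℝ))
    (f : Fin n → (Fin n → ℝ) → EuclideanSpace ℝ (Fin (n + 1)))
    (g : (Fin n → ℝ) → Matrix (Fin (n + 1)) (Fin (n + 1)) ℝ)
    (W : (Fin n → ℝ) → Matrix (Fin n) (Fin n) ℝ) : Prop where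
  smooth_g : MatSmooth U g
  smooth_W : MatSmooth U W
  orthogonal : ∀ x ∈ U, (g x)ᵀ * g x = 1
  ne_zero : ∀ x ∈ U, ∀ i l, W x i l ≠ 0
  pd_eq : ∀ x ∈ U, ∀ l i a, pd i (fun y => f l y a) x = W x i l * g x a i.castSucc

/-- A Combescure sequence has a common frame; its metric fields are independent and satisfy the
Guichard condition. -/
theorem exists_isFrame {n k : ℕ} (hn : 0 < n) {U : Set (Fin n → ℝ)} (hU : IsOpen U)
    {f : Fin n → (Fin n → ℝ) → EuclideanSpace ℝ (Fin (n + 1))} (hf : IsCombescureSequence k U f) :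
    ∃ g W, IsFrame U f g W ∧ (∀ x ∈ U, IsUnit (W x)) ∧
      ∀ x ∈ U, ∀ l, ∑ i, eps n k i * W x i l ^ 2 = 0 := by
  obtain ⟨u, hu, hpar, hind⟩ := hf.independent
  -- the principal directions are those of the first hypersurface
  let l₀ : Fin n := ⟨0, hn⟩
  have hfs : ∀ l a, ContDiffOn ℝ ∞ (fun y => f l y a) U := fun l a =>
    (EuclideanSpace.proj (𝕜 := ℝ) a).contDiff.comp_contDiffOn (hf.isothermic l).smooth
  have hcoord : ∀ l i a, ∀ x ∈ U, pd i (fun y => f l y a) x = (pd i (f l) x) a :=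
    fun l i a x hx => pd_clm_comp (EuclideanSpace.proj (𝕜 := ℝ) a)
      (differentiableAt_of_contDiffOn hU (hf.isothermic l).smooth hx) i
  have hnorm : ∀ l i, ∀ x ∈ U, ‖pd i (f l) x‖ ^ 2 = u l x i ^ 2 := by
    intro l i x hx
    rw [← real_inner_self_eq_norm_sq, (hu l).2 x hx i i, if_pos rfl]
  have hne : ∀ l i, ∀ x ∈ U, u l x i ≠ 0 := by
    intro l i x hx h0
    have h1 := hnorm l i x hx
    rw [h0, zero_pow two_ne_zero, sq_eq_zero_iff, norm_eq_zero] at h1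
    exact ((hf.isothermic l).immersion x hx).ne_zero i h1
  have hus : ∀ l i, ContDiffOn ℝ ∞ (fun x => u l x i) U := fun l i =>
    contDiffOn_pi.1 (hu l).1 i
  let e : (Fin n → ℝ) → Fin n → Fin (n + 1) → ℝ :=
    fun x i a => (u l₀ x i)⁻¹ * pd i (fun y => f l₀ y a) x
  have hes : ∀ i a, ContDiffOn ℝ ∞ (fun x => e x i a) U := fun i a =>
    ((hus l₀ i).inv fun x hx => hne l₀ i x hx).mul (contDiffOn_pd hU (hfs l₀ a) i)
  have hpd : ∀ x ∈ U, ∀ l i a, pd i (fun y => f l y a) x = u l x i * e x i a := by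
    intro x hx l i a
    have := congrArg (fun w : EuclideanSpace ℝ (Fin (n + 1)) => w a) (hpar x hx l l₀ i)
    simp only [PiLp.smul_apply, smul_eq_mul] at this
    simp only [e]
    rw [hcoord l₀ i a x hx, ← this, hcoord l i a x hx, mul_inv_cancel_left₀ (hne l i x hx)]
  have heo : ∀ x ∈ U, ∀ i j, e x i ⬝ᵥ e x j = if i = j then 1 else 0 := by
    intro x hx i j
    have h1 := (hu l₀).2 x hx i j
    rw [EuclideanSpace.inner_eq_star_dotProduct] at h1
    have he : ∀ i, e x i = (u l₀ x i)⁻¹ • (pd i (f l₀) x).ofLp := fun i => by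
      ext a; simp [e, hcoord l₀ i a x hx]
    rw [he, he, smul_dotProduct, dotProduct_smul, dotProduct_comm]
    rw [star_trivial] at h1
    rw [h1]
    split_ifs with hij
    · subst hij
      have := hne l₀ i x hx
      simp only [smul_eq_mul]
      field_simp
    · simp
  refine ⟨fun x => frameMat (e x), fun x => Matrix.of fun i l => u l x i, ⟨?_, fun i l => hus l i,
    fun x hx => frameMat_transpose_mul_self (heo x hx), fun x hx i l => hne l i x hx, ?_⟩, ?_, ?_⟩
  · intro a b
    refine Fin.lastCases ?_ (fun i => ?_) b
    · simpa only [frameMat_last] using contDiffOn_crossVec hes a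
    · simpa only [frameMat_castSucc] using hes i a
  · intro x hx l i a
    rw [hpd x hx, frameMat_castSucc]
    rfl
  · intro x hx
    rw [← Matrix.linearIndependent_cols_iff_isUnit]
    exact hind x hx
  · intro x hx l
    simpa only [hnorm l _ x hx, Matrix.of_apply] using (hf.isothermic l).guichard x hx

end Frame

/-! ### The structure equations of the frame -/

section Structure

/-- The `dxᵢ`-coefficient `gᵀ ∂ᵢg` of the connection form of the frame `g`. -/
noncomputable def conn {n : ℕ} (g : (Fin n → ℝ) → Matrix (Fin (n + 1)) (Fin (n + 1)) ℝ) (i : Fin n)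
    (x : Fin n → ℝ) : Matrix (Fin (n + 1)) (Fin (n + 1)) ℝ := (g x)ᵀ * matPd i g x

namespace IsFrame

variable {n k : ℕ} {U : Set (Fin n → ℝ)}
  {f : Fin n → (Fin n → ℝ) → EuclideanSpace ℝ (Fin (n + 1))}
  {g : (Fin n → ℝ) → Matrix (Fin (n + 1)) (Fin (n + 1)) ℝ}
  {W : (Fin n → ℝ) → Matrix (Fin n) (Fin n) ℝ}

lemma mul_conn (h : IsFrame U f g W) (i : Fin n) {x : Fin n → ℝ} (hx : x ∈ U) :
    g x * conn g i x = matPd i g x := by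
  rw [conn, ← Matrix.mul_assoc, mul_eq_one_comm.1 (h.orthogonal x hx), Matrix.one_mul]

lemma conn_transpose (h : IsFrame U f g W) (hU : IsOpen U) (i : Fin n) {x : Fin n → ℝ}
    (hx : x ∈ U) : (conn g i x)ᵀ = -conn g i x := by
  have h1 := matPd_mul hU h.smooth_g.transpose h.smooth_g hx i
  rw [matPd_congr hU h.orthogonal hx i, matPd_const, matPd_transpose] at h1
  rw [conn, Matrix.transpose_mul, Matrix.transpose_transpose]
  exact eq_neg_of_add_eq_zero_left h1.symm

lemma conn_antisymm (h : IsFrame U f g W) (hU : IsOpen U) (i : Fin n) {x : Fin n → ℝ}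
    (hx : x ∈ U) (b c : Fin (n + 1)) : conn g i x c b = -conn g i x b c :=
  congrFun (congrFun (h.conn_transpose hU i hx) b) c

lemma conn_self (h : IsFrame U f g W) (hU : IsOpen U) (i : Fin n) {x : Fin n → ℝ}
    (hx : x ∈ U) (b : Fin (n + 1)) : conn g i x b b = 0 := by
  linarith [h.conn_antisymm hU i hx b b]

lemma pd_pd_apply (h : IsFrame U f g W) (hU : IsOpen U) {x : Fin n → ℝ} (hx : x ∈ U)
    (l i j : Fin n) (a : Fin (n + 1)) :
    pd i (fun y => pd j (fun z => f l z a) y) x =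
      pd i (fun y => W y j l) x * g x a j.castSucc + W x j l * matPd i g x a j.castSucc := by
  rw [pd_congr hU (fun y hy => h.pd_eq y hy l j a) hx, pd_mul
    (differentiableAt_of_contDiffOn hU (h.smooth_W j l) hx)
    (differentiableAt_of_contDiffOn hU (h.smooth_g a j.castSucc) hx)]
  rfl

lemma sum_mul_pd_pd (h : IsFrame U f g W) (hU : IsOpen U) {x : Fin n → ℝ} (hx : x ∈ U)
    (l i j : Fin n) (b : Fin (n + 1)) :
    ∑ a, g x a b * pd i (fun y => pd j (fun z => f l z a) y) x =
      pd i (fun y => W y j l) x * (if b = j.castSucc then 1 else 0) +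
        W x j l * conn g i x b j.castSucc := by
  have h1 := congrFun (congrFun (h.orthogonal x hx) b) j.castSucc
  rw [Matrix.one_apply, Matrix.mul_apply] at h1
  rw [← h1, conn, Matrix.mul_apply, Finset.mul_sum, Finset.mul_sum, ← Finset.sum_add_distrib]
  refine Finset.sum_congr rfl fun a _ => ?_
  rw [h.pd_pd_apply hU hx, Matrix.transpose_apply]
  ring

/-- Symmetry of the second derivatives of `f l`, in components with respect to the frame. -/
lemma compat (h : IsFrame U f g W) (hU : IsOpen U)
    (hf : ∀ l a, ContDiffOn ℝ ∞ (fun y => f l y a) U) {x : Fin n → ℝ} (hx : x ∈ U)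
    (l i j : Fin n) (b : Fin (n + 1)) :
    pd i (fun y => W y j l) x * (if b = j.castSucc then 1 else 0) +
        W x j l * conn g i x b j.castSucc =
      pd j (fun y => W y i l) x * (if b = i.castSucc then 1 else 0) +
        W x i l * conn g j x b i.castSucc := by
  rw [← h.sum_mul_pd_pd hU hx, ← h.sum_mul_pd_pd hU hx]
  exact Finset.sum_congr rfl fun a _ => by
    congr 1
    exact pd_pd_comm hU (hf l a) hx i j

/-- The rotation coefficients `∂ⱼ W_p / Wⱼ` are entries of the connection form, hence the same for
all `f l`. -/
lemma pd_W_of_ne (h : IsFrame U f g W) (hU : IsOpen U)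
    (hf : ∀ l a, ContDiffOn ℝ ∞ (fun y => f l y a) U) {x : Fin n → ℝ} (hx : x ∈ U)
    (l : Fin n) {p j : Fin n} (hpj : p ≠ j) :
    pd j (fun y => W y p l) x = W x j l * conn g p x p.castSucc j.castSucc := by
  have h1 := h.compat hU hf hx l p j p.castSucc
  rw [h.conn_self hU j hx, if_neg (by simpa using hpj), if_pos rfl] at h1
  linarith

/-- The second fundamental form is diagonal. -/
lemma conn_last (h : IsFrame U f g W) (hU : IsOpen U) {l : Fin n} (hf : IsIsothermic k U (f l))
    {x : Fin n → ℝ} (hx : x ∈ U) {i j : Fin n} (hij : i ≠ j) :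
    conn g i x (Fin.last n) j.castSucc = 0 := by
  have hin : ∀ N w : EuclideanSpace ℝ (Fin (n + 1)), inner ℝ N w = ∑ a, N a * w a := by
    intro N w
    simp [PiLp.inner_apply, mul_comm]
  have hco : ∀ i a, ∀ y ∈ U, (pd i (f l) y) a = pd i (fun y => f l y a) y :=
    fun i a y hy => (pd_clm_comp (EuclideanSpace.proj (𝕜 := ℝ) a)
      (differentiableAt_of_contDiffOn hU hf.smooth hy) i).symm
  have hco2 : ∀ a, (pd i (pd j (f l)) x) a = pd i (fun y => pd j (fun z => f l z a) y) x := by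
    intro a
    rw [← pd_congr hU (fun y hy => hco j a y hy) hx]
    exact (pd_clm_comp (EuclideanSpace.proj (𝕜 := ℝ) a)
      (differentiableAt_of_contDiffOn hU (contDiffOn_pd hU hf.smooth j) hx) i).symm
  have horth : ∀ p : Fin n, ∑ a, g x a (Fin.last n) * g x a p.castSucc = 0 := by
    intro p
    have h1 := congrFun (congrFun (h.orthogonal x hx) (Fin.last n)) p.castSucc
    rwa [Matrix.one_apply_ne (Fin.castSucc_lt_last p).ne', Matrix.mul_apply] at h1
  have h2 := hf.second_diagonal x hx (WithLp.toLp 2 fun a => g x a (Fin.last n)) (fun p => by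
    rw [hin]
    simp only [hco p _ x hx, h.pd_eq x hx]
    calc _ = W x p l * ∑ a, g x a (Fin.last n) * g x a p.castSucc := by
          rw [Finset.mul_sum]; exact Finset.sum_congr rfl fun a _ => by ring
      _ = 0 := by rw [horth, mul_zero]) i j hij
  rw [hin] at h2
  simp only [hco2] at h2
  rw [h.sum_mul_pd_pd hU hx, if_neg (Fin.castSucc_lt_last j).ne', mul_zero, zero_add] at h2
  exact (mul_eq_zero.1 h2).resolve_left (h.ne_zero x hx j l)

/-- Row and column `i` carry all of `gᵀ ∂ᵢg`. For the normal direction this is the diagonality of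
the second fundamental form; for three distinct tangent directions it follows from the symmetry
of second derivatives. -/
lemma conn_eq_zero (h : IsFrame U f g W) (hU : IsOpen U) (hf : ∀ l, IsIsothermic k U (f l))
    (hfs : ∀ l a, ContDiffOn ℝ ∞ (fun y => f l y a) U)
    {x : Fin n → ℝ} (hx : x ∈ U) {i : Fin n} {b c : Fin (n + 1)}
    (hb : b ≠ i.castSucc) (hc : c ≠ i.castSucc) : conn g i x b c = 0 := by
  induction b using Fin.lastCases with
  | last =>
    induction c using Fin.lastCases with
    | last => exact h.conn_self hU i hx _
    | cast j => exact h.conn_last hU (hf i) hx (by rintro rfl; exact hc rfl)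
  | cast b =>
    induction c using Fin.lastCases with
    | last =>
      rw [h.conn_antisymm hU i hx, h.conn_last hU (hf i) hx (by rintro rfl; exact hb rfl), neg_zero]
    | cast j =>
      by_cases hbj : b = j
      · rw [hbj]; exact h.conn_self hU i hx _
      have hbi : b ≠ i := by rintro rfl; exact hb rfl
      have hji : j ≠ i := by rintro rfl; exact hc rfl
      -- multiplied by `w b * w j`, the entry `(b, j)` of `gᵀ ∂ᵢg` becomes symmetric in `i, j` and
      -- antisymmetric in `j, b`, hence zero
      set w : Fin n → ℝ := fun p => W x p i
      have hsymm : ∀ i j b : Fin n, b ≠ i → b ≠ j → w b * w j * conn g i x b.castSucc j.castSucc =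
          w b * w i * conn g j x b.castSucc i.castSucc := by
        intro p q b hp hq
        have h1 := h.compat hU hfs hx i p q b.castSucc
        rw [if_neg (by simpa using hq), if_neg (by simpa using hp)] at h1
        linear_combination w b * h1
      have hanti : ∀ i j b : Fin n, w b * w j * conn g i x b.castSucc j.castSucc =
          -(w j * w b * conn g i x j.castSucc b.castSucc) := by
        intro p q b
        rw [h.conn_antisymm hU p hx q.castSucc]
        ring
      have h0 : w b * w j * conn g i x b.castSucc j.castSucc = 0 := by
        linarith [hsymm i j b hbi hbj, hanti j i b, hsymm j b i (Ne.symm hji) (Ne.symm hbi),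
          hanti b j i, hsymm b i j (Ne.symm hbj) hji, hanti i b j]
      exact (mul_eq_zero.1 h0).resolve_left (mul_ne_zero (h.ne_zero x hx b i) (h.ne_zero x hx j i))

end IsFrame

end Structure

/-! ### The potential `ξ` and the linear system of the metric fields -/

section System

variable {n k : ℕ} {U : Set (Fin n → ℝ)}

/-- The `n × (n+1)` matrix `Aᵢ = (eᵢᵢ, 0)`. -/
def unitA {n : ℕ} (i : Fin n) : Matrix (Fin n) (Fin (n + 1)) ℝ := Matrix.single i i.castSucc 1

lemma a_eq (i : Fin n) : a k i = pElt k (unitA i) := rfl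

/-- The commutator of two elements of `𝔭` is block diagonal. -/
lemma comm_pElt (ξ η : Matrix (Fin n) (Fin (n + 1)) ℝ) :
    comm (pElt k ξ) (pElt k η) = Matrix.fromBlocks (ηᵀ * J n k * ξ - ξᵀ * J n k * η) 0 0
      (η * ξᵀ * J n k - ξ * ηᵀ * J n k) := by
  rw [comm, pElt, pElt, Matrix.fromBlocks_multiply, Matrix.fromBlocks_multiply, sub_eq_add_neg,
    Matrix.fromBlocks_neg, Matrix.fromBlocks_add]
  congr 1 <;> simp [Matrix.mul_assoc] <;> abel

/-- The matrix `ξ = (F, γ)` of the frame `g`: its `i`-th row is `εᵢ` times the `i`-th column of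
`gᵀ ∂ᵢg`, so that `gᵀ ∂ᵢg` becomes the upper block of `[aᵢ, v]`. -/
noncomputable def xiMat (k : ℕ) (g : (Fin n → ℝ) → Matrix (Fin (n + 1)) (Fin (n + 1)) ℝ)
    (x : Fin n → ℝ) : Matrix (Fin n) (Fin (n + 1)) ℝ :=
  Matrix.of fun i b => eps n k i * conn g i x b i.castSucc

lemma joinCol_init_last (ξ : Matrix (Fin n) (Fin (n + 1)) ℝ) :
    joinCol (Matrix.of fun i j => ξ i j.castSucc) (fun i => ξ i (Fin.last n)) = ξ := by
  ext i b
  induction b using Fin.lastCases <;> simp [joinCol]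

lemma unitA_transpose_mul_apply (i : Fin n) {κ : Type*} (M : Matrix (Fin n) κ ℝ) (b : Fin (n + 1))
    (c : κ) : ((unitA i)ᵀ * M) b c = if b = i.castSucc then M i c else 0 := by
  rw [unitA, Matrix.transpose_single]
  split_ifs with h
  · rw [h, Matrix.single_mul_apply_same, one_mul]
  · rw [Matrix.single_mul_apply_of_ne (h := h)]

lemma mul_unitA_apply (i : Fin n) {κ : Type*} (M : Matrix κ (Fin n) ℝ) (b : κ)
    (c : Fin (n + 1)) : (M * unitA i) b c = if c = i.castSucc then M b i else 0 := by
  rw [unitA]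
  split_ifs with h
  · rw [h, Matrix.mul_single_apply_same, mul_one]
  · rw [Matrix.mul_single_apply_of_ne (hbj := h)]

lemma unitA_mul_apply (i : Fin n) {κ : Type*} (M : Matrix (Fin (n + 1)) κ ℝ) (p : Fin n)
    (c : κ) : (unitA i * M) p c = if p = i then M i.castSucc c else 0 := by
  rw [unitA]
  split_ifs with h
  · rw [h, Matrix.single_mul_apply_same, one_mul]
  · rw [Matrix.single_mul_apply_of_ne (h := h)]

lemma mul_unitA_transpose_apply (i : Fin n) {κ : Type*} (M : Matrix κ (Fin (n + 1)) ℝ) (b : κ)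
    (q : Fin n) : (M * (unitA i)ᵀ) b q = if q = i then M b i.castSucc else 0 := by
  rw [unitA, Matrix.transpose_single]
  split_ifs with h
  · rw [h, Matrix.mul_single_apply_same, mul_one]
  · rw [Matrix.mul_single_apply_of_ne (hbj := h)]

lemma comm_a_a (i j : Fin n) : comm (a k i) (a k j) = 0 := by
  by_cases hij : i = j
  · subst hij; simp [comm]
  have h1 : ∀ p q : Fin n, p ≠ q → (unitA p)ᵀ * J n k * unitA q = 0 := by
    intro p q hpq
    ext b c
    rw [mul_unitA_apply, unitA_transpose_mul_apply, J, Matrix.diagonal_apply_ne _ hpq]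
    simp
  have h2 : ∀ p q : Fin n, p ≠ q → unitA p * (unitA q)ᵀ = 0 := by
    intro p q hpq
    rw [unitA, unitA, Matrix.transpose_single, Matrix.single_mul_single_of_ne]
    simpa using hpq
  rw [a_eq, a_eq, comm_pElt, h1 _ _ hij, h1 _ _ (Ne.symm hij), h2 _ _ hij, h2 _ _ (Ne.symm hij)]
  simp

/-- The lower diagonal block `ξ Aᵢᵀ J - Aᵢ ξᵀ J` of `[aᵢ, v]`. -/
noncomputable def lowerBlock (k : ℕ) (i : Fin n) (ξ : Matrix (Fin n) (Fin (n + 1)) ℝ) :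
    Matrix (Fin n) (Fin n) ℝ := ξ * (unitA i)ᵀ * J n k - unitA i * ξᵀ * J n k

lemma lowerBlock_transpose (i : Fin n) (ξ : Matrix (Fin n) (Fin (n + 1)) ℝ) :
    (lowerBlock k i ξ)ᵀ = J n k * (unitA i * ξᵀ) - J n k * (ξ * (unitA i)ᵀ) := by
  simp [lowerBlock, J_transpose]

/-- The lower block lies in the Lie algebra of `O(n-k, k)`. -/
lemma lowerBlock_skew (i : Fin n) (ξ : Matrix (Fin n) (Fin (n + 1)) ℝ) :
    lowerBlock k i ξ * J n k + J n k * (lowerBlock k i ξ)ᵀ = 0 := by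
  rw [lowerBlock_transpose, lowerBlock, Matrix.sub_mul, Matrix.mul_sub, ← Matrix.mul_assoc (J n k),
    ← Matrix.mul_assoc (J n k) (J n k), J_mul_J, Matrix.mul_assoc _ (J n k) (J n k),
    Matrix.mul_assoc _ (J n k) (J n k), J_mul_J]
  simp

namespace IsFrame

variable {f : Fin n → (Fin n → ℝ) → EuclideanSpace ℝ (Fin (n + 1))}
  {g : (Fin n → ℝ) → Matrix (Fin (n + 1)) (Fin (n + 1)) ℝ}
  {W : (Fin n → ℝ) → Matrix (Fin n) (Fin n) ℝ}

lemma smooth_xiMat (h : IsFrame U f g W) (hU : IsOpen U) : MatSmooth U (xiMat k g) := by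
  intro i b
  exact contDiffOn_const.mul
    ((h.smooth_g.transpose.mul (h.smooth_g.matPd hU i)) b i.castSucc)

lemma xiMat_diag (h : IsFrame U f g W) (hU : IsOpen U) {x : Fin n → ℝ} (hx : x ∈ U) (i : Fin n) :
    xiMat k g x i i.castSucc = 0 := by
  rw [xiMat, Matrix.of_apply, h.conn_self hU i hx, mul_zero]

/-- The upper block of `[aᵢ, v]` is `gᵀ ∂ᵢg`. -/
lemma conn_eq_upperBlock (h : IsFrame U f g W) (hU : IsOpen U)
    (hf : ∀ l, IsIsothermic k U (f l)) (hfs : ∀ l a, ContDiffOn ℝ ∞ (fun y => f l y a) U)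
    {x : Fin n → ℝ} (hx : x ∈ U) (i : Fin n) :
    (xiMat k g x)ᵀ * J n k * unitA i - (unitA i)ᵀ * J n k * xiMat k g x = conn g i x := by
  have hε := eps_mul_self n k i
  ext b c
  rw [Matrix.sub_apply, mul_unitA_apply, Matrix.mul_assoc, unitA_transpose_mul_apply, J,
    Matrix.mul_diagonal, Matrix.diagonal_mul]
  simp only [xiMat, Matrix.transpose_apply, Matrix.of_apply]
  by_cases hc : c = i.castSucc <;> by_cases hb : b = i.castSucc
  · rw [if_pos hc, if_pos hb, hb, hc, h.conn_self hU i hx]; simp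
  · rw [if_pos hc, if_neg hb, hc]
    linear_combination conn g i x b i.castSucc * hε
  · rw [if_neg hc, if_pos hb, hb, h.conn_antisymm hU i hx]
    linear_combination conn g i x i.castSucc c * hε
  · rw [if_neg hc, if_neg hb, h.conn_eq_zero hU hf hfs hx hb hc, sub_zero]

/-- The metric fields solve the linear system whose coefficients are the transposed lower blocks
of `[aᵢ, v]`; the diagonal component comes from differentiating the Guichard condition. -/
lemma matPd_W (h : IsFrame U f g W) (hU : IsOpen U)
    (hfs : ∀ l a, ContDiffOn ℝ ∞ (fun y => f l y a) U)
    (hG : ∀ x ∈ U, ∀ l, ∑ i, eps n k i * W x i l ^ 2 = 0)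
    {x : Fin n → ℝ} (hx : x ∈ U) (j : Fin n) :
    matPd j W x = (lowerBlock k j (xiMat k g x))ᵀ * W x := by
  set ξ := xiMat k g x with hξ
  have hε := eps_mul_self n k
  have hoff : ∀ l p, p ≠ j → matPd j W x p l = -(eps n k p * ξ p j.castSucc * W x j l) := by
    intro l p hp
    change pd j (fun y => W y p l) x = _
    rw [h.pd_W_of_ne hU hfs hx l hp, hξ, xiMat, Matrix.of_apply, h.conn_antisymm hU p hx]
    linear_combination (W x j l * conn g p x j.castSucc p.castSucc) * hε p
  have hentry : ∀ p l, ((lowerBlock k j ξ)ᵀ * W x) p l =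
      (if p = j then eps n k p * ∑ q, ξ q j.castSucc * W x q l else 0) -
        eps n k p * ξ p j.castSucc * W x j l := by
    intro p l
    rw [lowerBlock_transpose, Matrix.sub_mul, Matrix.sub_apply, Matrix.mul_assoc, Matrix.mul_assoc,
      Matrix.mul_assoc, J, Matrix.diagonal_mul, Matrix.diagonal_mul, unitA_mul_apply]
    congr 1
    · split_ifs with hp
      · simp [Matrix.mul_apply]
      · simp
    · rw [mul_assoc]
      congr 1
      rw [Matrix.mul_apply]
      simp only [mul_unitA_transpose_apply]
      simp
  have hd : ∀ l, ∑ q, eps n k q * (W x q l * matPd j W x q l) = 0 := by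
    intro l
    have h1 : pd j (fun y => ∑ q, eps n k q * (W y q l * W y q l)) x = 0 := by
      rw [pd_congr hU (h := fun _ => (0 : ℝ)) (fun y hy => ?_) hx, pd_const]
      rw [← hG y hy l]
      exact Finset.sum_congr rfl fun q _ => by ring
    have hWd := fun q => differentiableAt_of_contDiffOn hU (h.smooth_W q l) hx
    rw [pd_sum _ fun q _ => ((hWd q).fun_mul (hWd q)).const_mul _] at h1
    have h2 : ∀ q, pd j (fun y => eps n k q * (W y q l * W y q l)) x =
        2 * (eps n k q * (W x q l * matPd j W x q l)) := by
      intro q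
      rw [pd_mul (differentiableAt_const _) ((hWd q).fun_mul (hWd q)), pd_mul (hWd q) (hWd q),
        pd_const]
      change _ = 2 * (eps n k q * (W x q l * pd j (fun y => W y q l) x))
      ring
    simp only [h2] at h1
    rw [← Finset.mul_sum] at h1
    linarith
  ext p l
  rw [hentry]
  by_cases hp : p = j
  · subst hp
    rw [if_pos rfl, hξ, h.xiMat_diag hU hx, ← hξ]
    have h1 := hd l
    rw [← Finset.add_sum_erase _ _ (Finset.mem_univ p)] at h1 ⊢
    rw [Finset.sum_congr rfl (g := fun q => -(W x p l * (ξ q p.castSucc * W x q l))) (fun q hq => by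
      rw [hoff l q (Finset.ne_of_mem_erase hq)]
      linear_combination (-W x q l * ξ q p.castSucc * W x p l) * hε q)] at h1
    rw [Finset.sum_neg_distrib, ← Finset.mul_sum] at h1
    have hd0 : ξ p p.castSucc = 0 := h.xiMat_diag hU hx p
    rw [hd0]
    refine mul_left_cancel₀ (h.ne_zero x hx p l) ?_
    linear_combination eps n k p * h1 - (W x p l * matPd p W x p l) * hε p
  · rw [if_neg hp, hoff l p hp, zero_sub]

end IsFrame

end System

/-! ### The frame at `λ = 0` -/

section BlockFrame

variable {n k : ℕ} {U : Set (Fin n → ℝ)}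

/-- The Gram matrix `diag(I_{n+1}, J)` as a real matrix. -/
noncomputable def gramReal (n k : ℕ) : Matrix (Idx n) (Idx n) ℝ := Matrix.fromBlocks 1 0 0 (J n k)

lemma gramReal_mul_self : gramReal n k * gramReal n k = 1 := by
  rw [gramReal, Matrix.fromBlocks_multiply]
  simp [J_mul_J]

/-- The element `(0, Y; -J Yᵀ, 0)` of the `-1`-eigenspace `𝔭`. -/
noncomputable def skewBlock (k : ℕ) (Y : Matrix (Fin (n + 1)) (Fin n) ℝ) :
    Matrix (Idx n) (Idx n) ℝ := Matrix.fromBlocks 0 Y (-(J n k * Yᵀ)) 0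

lemma matPd_skewBlock (hU : IsOpen U) {Y : (Fin n → ℝ) → Matrix (Fin (n + 1)) (Fin n) ℝ}
    (hY : MatSmooth U Y) {x : Fin n → ℝ} (hx : x ∈ U) (i : Fin n) :
    matPd i (fun x => skewBlock k (Y x)) x = skewBlock k (matPd i Y x) := by
  simp only [skewBlock]
  rw [matPd_fromBlocks, matPd_const, matPd_const, matPd_neg,
    matPd_const_mul hU _ hY.transpose hx, matPd_transpose]

/-- The second block `(W W(0)⁻¹)ᵀ` of the frame at `λ = 0`, normalised to be `1` at `0`. -/
noncomputable def lowerFrame (W : (Fin n → ℝ) → Matrix (Fin n) (Fin n) ℝ) (x : Fin n → ℝ) :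
    Matrix (Fin n) (Fin n) ℝ := (W x * (W 0)⁻¹)ᵀ

/-- The frame at `λ = 0`: block diagonal, with blocks the geometric frame `g` and `lowerFrame W`. -/
noncomputable def blockFrame (g : (Fin n → ℝ) → Matrix (Fin (n + 1)) (Fin (n + 1)) ℝ)
    (W : (Fin n → ℝ) → Matrix (Fin n) (Fin n) ℝ) (x : Fin n → ℝ) : Matrix (Idx n) (Idx n) ℝ :=
  Matrix.fromBlocks (g x) 0 0 (lowerFrame W x)

/-- A frame `E` with `E⁻¹ ∂ᵢE = [aᵢ, v]` forces `v` to satisfy the system, which is then the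
symmetry of the second derivatives of `E`. -/
lemma pde_of_frame (hU : IsOpen U) {E v : (Fin n → ℝ) → Matrix (Idx n) (Idx n) ℝ}
    (hE : MatSmooth U E) (hv : MatSmooth U v) (hunit : ∀ x ∈ U, IsUnit (E x))
    (hEv : ∀ x ∈ U, ∀ i, matPd i E x = E x * comm (a k i) (v x)) {x : Fin n → ℝ} (hx : x ∈ U)
    (i j : Fin n) :
    comm (a k i) (matPd j v x) - comm (a k j) (matPd i v x)
      - comm (comm (a k i) (v x)) (comm (a k j) (v x)) = 0 := by
  have hcs : ∀ i, MatSmooth U fun x => comm (a k i) (v x) := fun i =>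
    ((MatSmooth.const (a k i)).mul hv).sub (hv.mul (.const (a k i)))
  have hc : ∀ i j, matPd j (fun y => comm (a k i) (v y)) x = comm (a k i) (matPd j v x) := by
    intro i j
    simp only [comm]
    rw [matPd_sub hU ((MatSmooth.const (a k i)).mul hv) (hv.mul (.const (a k i))) hx,
      matPd_const_mul hU _ hv hx, matPd_mul_const hU hv _ hx]
  have h2 : ∀ i j, matPd j (matPd i E) x =
      E x * (comm (a k j) (v x) * comm (a k i) (v x) + comm (a k i) (matPd j v x)) := by
    intro i j
    rw [matPd_congr hU (fun y hy => hEv y hy i) hx, matPd_mul hU hE (hcs i) hx, hEv x hx, hc,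
      Matrix.mul_add, Matrix.mul_assoc]
  have h3 := matPd_matPd_comm hU hE hx j i
  rw [h2, h2] at h3
  have h4 := (hunit x hx).mul_left_cancel h3
  have h5 : comm (comm (a k i) (v x)) (comm (a k j) (v x)) =
      comm (a k i) (v x) * comm (a k j) (v x) - comm (a k j) (v x) * comm (a k i) (v x) := rfl
  rw [h5]
  linear_combination (norm := abel) h4

/-- The solution `Y` of `Y C = (f₁, …, fₙ)` with `C = -J W(0)`. The columns of `C` are null vectors
by the Guichard condition at `0`; the sign makes `∂ᵢ` of `skewBlock k Y` conjugate to `aᵢ` rather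
than to `-aᵢ`. -/
noncomputable def immersionMat (k : ℕ) (f : Fin n → (Fin n → ℝ) → EuclideanSpace ℝ (Fin (n + 1)))
    (W₀ : Matrix (Fin n) (Fin n) ℝ) (x : Fin n → ℝ) : Matrix (Fin (n + 1)) (Fin n) ℝ :=
  (Matrix.of fun a l => f l x a) * -(W₀⁻¹ * J n k)

lemma immersionMat_mul (k : ℕ) (f : Fin n → (Fin n → ℝ) → EuclideanSpace ℝ (Fin (n + 1)))
    {W₀ : Matrix (Fin n) (Fin n) ℝ} (hW : IsUnit W₀) (x : Fin n → ℝ) :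
    immersionMat k f W₀ x * -(J n k * W₀) = Matrix.of fun a l => f l x a := by
  simp only [immersionMat, Matrix.mul_neg, Matrix.neg_mul, neg_neg]
  rw [Matrix.mul_assoc, Matrix.mul_assoc, ← Matrix.mul_assoc (J n k), J_mul_J, Matrix.one_mul,
    Matrix.nonsing_inv_mul _ ((Matrix.isUnit_iff_isUnit_det _).1 hW),
    Matrix.mul_one]

lemma smooth_immersionMat {f : Fin n → (Fin n → ℝ) → EuclideanSpace ℝ (Fin (n + 1))}
    (hfs : ∀ l a, ContDiffOn ℝ ∞ (fun y => f l y a) U)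
    (W₀ : Matrix (Fin n) (Fin n) ℝ) : MatSmooth U (immersionMat k f W₀) :=
  MatSmooth.mul (M := fun x => Matrix.of fun a l => f l x a) (fun a l => hfs l a) (.const _)

namespace IsFrame

variable {f : Fin n → (Fin n → ℝ) → EuclideanSpace ℝ (Fin (n + 1))}
  {g : (Fin n → ℝ) → Matrix (Fin (n + 1)) (Fin (n + 1)) ℝ}
  {W : (Fin n → ℝ) → Matrix (Fin n) (Fin n) ℝ}

lemma smooth_lowerFrame (h : IsFrame U f g W) : MatSmooth U (lowerFrame W) :=
  (h.smooth_W.mul (.const _)).transpose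

lemma smooth_blockFrame (h : IsFrame U f g W) : MatSmooth U (blockFrame g W) :=
  h.smooth_g.fromBlocks (.const 0) (.const 0) h.smooth_lowerFrame

lemma matPd_lowerFrame (h : IsFrame U f g W) (hU : IsOpen U)
    (hfs : ∀ l a, ContDiffOn ℝ ∞ (fun y => f l y a) U)
    (hG : ∀ x ∈ U, ∀ l, ∑ i, eps n k i * W x i l ^ 2 = 0)
    {x : Fin n → ℝ} (hx : x ∈ U) (i : Fin n) :
    matPd i (lowerFrame W) x = lowerFrame W x * lowerBlock k i (xiMat k g x) := by
  change (matPd i (fun y => W y * (W 0)⁻¹) x)ᵀ = _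
  rw [matPd_mul_const hU h.smooth_W _ hx, h.matPd_W hU hfs hG hx, lowerFrame, Matrix.mul_assoc,
    Matrix.transpose_mul _ (W x * _), Matrix.transpose_transpose]

/-- `lowerFrame W` takes values in `O(n-k, k)`, since its connection form does so in the Lie algebra
and it is `1` at `0`. -/
lemma lowerFrame_J (h : IsFrame U f g W) (hU : IsOpen U) (hUc : IsPreconnected U)
    (hU0 : (0 : Fin n → ℝ) ∈ U) (hfs : ∀ l a, ContDiffOn ℝ ∞ (fun y => f l y a) U)
    (hG : ∀ x ∈ U, ∀ l, ∑ i, eps n k i * W x i l ^ 2 = 0) (hW : IsUnit (W 0))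
    {x : Fin n → ℝ} (hx : x ∈ U) : lowerFrame W x * J n k * (lowerFrame W x)ᵀ = J n k := by
  have hS : (lowerFrame W 0) = 1 := by
    rw [lowerFrame, Matrix.mul_nonsing_inv _ ((Matrix.isUnit_iff_isUnit_det _).1 hW),
      Matrix.transpose_one]
  have hs := h.smooth_lowerFrame
  rw [eq_of_matPd_eq_zero hU hUc (M := fun x => lowerFrame W x * J n k * (lowerFrame W x)ᵀ)
    ((hs.mul (.const _)).mul hs.transpose) (fun y hy i => ?_) hx hU0, hS]
  · simp
  · rw [matPd_mul hU (hs.mul (.const _)) hs.transpose hy, matPd_mul_const hU hs _ hy,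
      matPd_transpose, h.matPd_lowerFrame hU hfs hG hy, Matrix.transpose_mul]
    have h0 := lowerBlock_skew (k := k) i (xiMat k g y)
    calc _ = lowerFrame W y * (lowerBlock k i (xiMat k g y) * J n k +
          J n k * (lowerBlock k i (xiMat k g y))ᵀ) * (lowerFrame W y)ᵀ := by
          simp only [Matrix.mul_add, Matrix.add_mul, Matrix.mul_assoc]
      _ = 0 := by rw [h0]; simp

lemma blockFrame_gram (h : IsFrame U f g W) (hU : IsOpen U) (hUc : IsPreconnected U)
    (hU0 : (0 : Fin n → ℝ) ∈ U) (hfs : ∀ l a, ContDiffOn ℝ ∞ (fun y => f l y a) U)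
    (hG : ∀ x ∈ U, ∀ l, ∑ i, eps n k i * W x i l ^ 2 = 0) (hW : IsUnit (W 0))
    {x : Fin n → ℝ} (hx : x ∈ U) :
    blockFrame g W x * gramReal n k * (blockFrame g W x)ᵀ = gramReal n k := by
  rw [blockFrame, gramReal, Matrix.fromBlocks_transpose, Matrix.fromBlocks_multiply,
    Matrix.fromBlocks_multiply]
  have h1 := h.lowerFrame_J hU hUc hU0 hfs hG hW hx
  have h2 := mul_eq_one_comm.1 (h.orthogonal x hx)
  simp [h1, h2]

lemma matPd_blockFrame (h : IsFrame U f g W) (hU : IsOpen U)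
    (hf : ∀ l, IsIsothermic k U (f l)) (hfs : ∀ l a, ContDiffOn ℝ ∞ (fun y => f l y a) U)
    (hG : ∀ x ∈ U, ∀ l, ∑ i, eps n k i * W x i l ^ 2 = 0)
    {x : Fin n → ℝ} (hx : x ∈ U) (i : Fin n) :
    matPd i (blockFrame g W) x =
      blockFrame g W x * comm (a k i) (pElt k (xiMat k g x)) := by
  rw [a_eq, comm_pElt, h.conn_eq_upperBlock hU hf hfs hx]
  change matPd i (fun y => Matrix.fromBlocks (g y) 0 0 (lowerFrame W y)) x = _
  rw [matPd_fromBlocks, blockFrame, Matrix.fromBlocks_multiply, h.matPd_lowerFrame hU hfs hG hx,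
    matPd_const, matPd_const, ← h.mul_conn i hx, lowerBlock]
  simp

lemma matPd_immersionMat (h : IsFrame U f g W) (hU : IsOpen U)
    (hfs : ∀ l a, ContDiffOn ℝ ∞ (fun y => f l y a) U) {x : Fin n → ℝ} (hx : x ∈ U) (i : Fin n) :
    matPd i (immersionMat k f (W 0)) x =
      -(g x * (unitA i)ᵀ * (lowerFrame W x)ᵀ * J n k) := by
  change matPd i (fun y => (Matrix.of fun a l => f l y a) * -((W 0)⁻¹ * J n k)) x = _
  rw [matPd_mul_const (M := fun y => Matrix.of fun a l => f l y a) hU (fun a l => hfs l a) _ hx]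
  have h1 : matPd i (fun y => Matrix.of fun a l => f l y a) x = g x * (unitA i)ᵀ * W x := by
    ext a l
    change pd i (fun y => f l y a) x = _
    rw [h.pd_eq x hx, Matrix.mul_apply]
    simp [mul_unitA_transpose_apply, mul_comm]
  rw [h1, lowerFrame, Matrix.transpose_transpose]
  simp only [Matrix.mul_neg, Matrix.mul_assoc]

/-- `∂ᵢZ` for `Z = skewBlock k Y` is the conjugate of `aᵢ` by the frame at `λ = 0`; hence these
partial derivatives commute. -/
lemma matPd_skewBlock_mul (h : IsFrame U f g W) (hU : IsOpen U) (hUc : IsPreconnected U)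
    (hU0 : (0 : Fin n → ℝ) ∈ U) (hfs : ∀ l a, ContDiffOn ℝ ∞ (fun y => f l y a) U)
    (hG : ∀ x ∈ U, ∀ l, ∑ i, eps n k i * W x i l ^ 2 = 0) (hW : IsUnit (W 0))
    {x : Fin n → ℝ} (hx : x ∈ U) (i : Fin n) :
    matPd i (fun y => skewBlock k (immersionMat k f (W 0) y)) x * blockFrame g W x =
      blockFrame g W x * a k i := by
  have hY := h.matPd_immersionMat (k := k) hU hfs hx i
  have hs := smooth_immersionMat (k := k) hfs (W 0)
  have h1 := h.lowerFrame_J hU hUc hU0 hfs hG hW hx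
  have h2 : (lowerFrame W x)ᵀ * J n k * lowerFrame W x = J n k := by
    have h3 : lowerFrame W x * (J n k * (lowerFrame W x)ᵀ * J n k) = 1 := by
      rw [← Matrix.mul_assoc, ← Matrix.mul_assoc, h1, J_mul_J]
    have h4 := mul_eq_one_comm.1 h3
    calc _ = J n k * (J n k * (lowerFrame W x)ᵀ * J n k * lowerFrame W x) := by
          simp only [← Matrix.mul_assoc, J_mul_J, Matrix.one_mul]
      _ = J n k := by rw [h4, Matrix.mul_one]
  have hE : (g x)ᵀ * g x = 1 := h.orthogonal x hx
  rw [matPd_skewBlock hU hs hx, skewBlock, hY, blockFrame, a_eq, pElt, Matrix.fromBlocks_multiply,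
    Matrix.fromBlocks_multiply]
  congr 1
  · simp
  · simp only [zero_add, Matrix.mul_zero, add_zero, Matrix.neg_mul,
      Matrix.mul_neg, neg_inj]
    simp only [Matrix.mul_assoc] at h2 ⊢
    rw [h2]
  · simp only [zero_add, Matrix.mul_zero, add_zero, Matrix.transpose_neg,
      Matrix.mul_neg, neg_neg, Matrix.transpose_mul, Matrix.transpose_transpose, J_transpose]
    calc _ = (J n k * J n k) * lowerFrame W x * unitA i * ((g x)ᵀ * g x) := by
          simp only [Matrix.mul_assoc]
      _ = _ := by rw [J_mul_J, hE, Matrix.one_mul, Matrix.mul_one]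
  · simp

end IsFrame

end BlockFrame

/-! ### The extended frame -/

section PartialDerivatives

variable {n : ℕ} {𝔸 : Type*} [NormedRing 𝔸] [NormedAlgebra ℝ 𝔸]

lemma commute_fderiv {Z : (Fin n → ℝ) → 𝔸} {x : Fin n → ℝ}
    (h : ∀ i j, Commute (pd i Z x) (pd j Z x)) (v w : Fin n → ℝ) :
    Commute (fderiv ℝ Z x v) (fderiv ℝ Z x w) := by
  rw [fderiv_eq_sum_pd, fderiv_eq_sum_pd]
  exact Commute.sum_left _ _ _ fun i _ => Commute.sum_right _ _ _ fun j _ =>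
    ((h i j).smul_left _).smul_right _

lemma map_fderiv_eq_smul {Z : (Fin n → ℝ) → 𝔸} {x : Fin n → ℝ} {σ : 𝔸 →+* 𝔸} (hσ : Continuous σ)
    {c : ℝ} (h : ∀ i, σ (pd i Z x) = c • pd i Z x) (v : Fin n → ℝ) :
    σ (fderiv ℝ Z x v) = c • fderiv ℝ Z x v := by
  rw [fderiv_eq_sum_pd, map_sum, Finset.smul_sum]
  refine Finset.sum_congr rfl fun i _ => ?_
  rw [map_real_smul (σ : 𝔸 →+* 𝔸) hσ, h, smul_comm]

end PartialDerivatives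

section Extended

attribute [local instance] Matrix.linftyOpNormedRing Matrix.linftyOpNormedAlgebra

variable {n k : ℕ} {U : Set (Fin n → ℝ)}

/-- The real-linear continuous map that takes a complex matrix to its entry `(p, q)`. -/
noncomputable def entryCLM (p q : Idx n) : Matrix (Idx n) (Idx n) ℂ →L[ℝ] ℂ :=
  LinearMap.toContinuousLinearMap (Matrix.entryLinearMap ℝ ℂ p q)

lemma matSmooth_iff_contDiffOn {M : (Fin n → ℝ) → Matrix (Idx n) (Idx n) ℂ} :
    MatSmooth U M ↔ ContDiffOn ℝ ∞ M U := by
  constructor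
  · intro h
    have h1 : M = fun x => ∑ p, ∑ q, M x p q • Matrix.single p q (1 : ℂ) := by
      ext1 x
      conv_lhs => rw [Matrix.matrix_eq_sum_single (M x)]
      simp
    rw [h1]
    exact ContDiffOn.sum fun p _ => ContDiffOn.sum fun q _ => (h p q).smul contDiffOn_const
  · intro h p q
    exact (entryCLM p q).contDiff.comp_contDiffOn h

lemma matPd_eq_pd {M : (Fin n → ℝ) → Matrix (Idx n) (Idx n) ℂ} {x : Fin n → ℝ}
    (h : DifferentiableAt ℝ M x) (i : Fin n) : matPd i M x = pd i M x := by
  ext p q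
  exact pd_clm_comp (entryCLM p q) h i

lemma invol_mul_self : invol n * invol n = 1 := by
  rw [invol, Matrix.fromBlocks_multiply]
  simp

/-- Conjugation by `invol n`, as a ring homomorphism. -/
noncomputable def involHom (n : ℕ) : Matrix (Idx n) (Idx n) ℂ →+* Matrix (Idx n) (Idx n) ℂ where
  toFun M := invol n * (M * invol n)
  map_one' := by rw [Matrix.one_mul, invol_mul_self]
  map_mul' M N := by
    simp only [Matrix.mul_assoc]
    rw [← Matrix.mul_assoc (invol n) (invol n), invol_mul_self, Matrix.one_mul]
  map_zero' := by simp
  map_add' M N := by rw [Matrix.add_mul, Matrix.mul_add]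

lemma involHom_apply (M : Matrix (Idx n) (Idx n) ℂ) :
    involHom n M = invol n * (M * invol n) := rfl

lemma involHom_skewBlock (Y : Matrix (Fin (n + 1)) (Fin n) ℝ) :
    involHom n ((skewBlock k Y).map Complex.ofReal) =
      (-1 : ℝ) • (skewBlock k Y).map Complex.ofReal := by
  rw [involHom_apply, skewBlock, invol, Matrix.fromBlocks_map, Matrix.fromBlocks_multiply,
    Matrix.fromBlocks_multiply, neg_one_smul, Matrix.fromBlocks_neg]
  congr 1 <;> ext <;> simp

lemma gram_eq : gram n k = (gramReal n k).map Complex.ofReal := by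
  ext (a | a) (b | b) <;> simp [gram, gramReal, Matrix.one_apply]
  split_ifs <;> simp

lemma map_ofReal_mul {ι κ μ : Type*} [Fintype κ] (M : Matrix ι κ ℝ) (N : Matrix κ μ ℝ) :
    (M * N).map Complex.ofReal = M.map Complex.ofReal * N.map Complex.ofReal :=
  Matrix.map_mul (f := Complex.ofRealHom)

/-- If `Z = skewBlock k Y` satisfies `∂ᵢZ = E₀ aᵢ E₀⁻¹` for a block diagonal orthogonal frame `E₀`
with `E₀⁻¹ ∂ᵢE₀ = [aᵢ, v]`, then `E_λ = G_λ E₀` is an extended frame, where `G_λ` is the generating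
series of the iterated primitives of `Z`, and `∂E/∂λ E⁻¹ = Z` at `λ = 0`. -/
theorem exists_extendedFrame (hU : IsOpen U) (hUs : IsSimplyConnected U)
    (hU0 : (0 : Fin n → ℝ) ∈ U) {F : (Fin n → ℝ) → Matrix (Fin n) (Fin n) ℝ}
    {γ : (Fin n → ℝ) → Fin n → ℝ} {A : (Fin n → ℝ) → Matrix (Fin (n + 1)) (Fin (n + 1)) ℝ}
    {B : (Fin n → ℝ) → Matrix (Fin n) (Fin n) ℝ}
    {Y : (Fin n → ℝ) → Matrix (Fin (n + 1)) (Fin n) ℝ} (hY : MatSmooth U Y) (hY0 : Y 0 = 0)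
    (hE : MatSmooth U fun x => Matrix.fromBlocks (A x) 0 0 (B x))
    (hgram : ∀ x ∈ U, Matrix.fromBlocks (A x) 0 0 (B x) * gramReal n k *
      (Matrix.fromBlocks (A x) 0 0 (B x))ᵀ = gramReal n k)
    (hEv : ∀ x ∈ U, ∀ i, matPd i (fun x => Matrix.fromBlocks (A x) 0 0 (B x)) x =
      Matrix.fromBlocks (A x) 0 0 (B x) * comm (a k i) (vMap k F γ x))
    (hZE : ∀ x ∈ U, ∀ i, matPd i (fun x => skewBlock k (Y x)) x *
      Matrix.fromBlocks (A x) 0 0 (B x) = Matrix.fromBlocks (A x) 0 0 (B x) * a k i) :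
    ∃ E, IsExtendedFrame k U F γ E ∧
      ∀ x ∈ U, symMap E x = (skewBlock k (Y x)).map Complex.ofReal := by
  have hUc : IsPreconnected U := hUs.isPathConnected.isConnected.isPreconnected
  set E₀ : (Fin n → ℝ) → Matrix (Idx n) (Idx n) ℝ :=
    fun x => Matrix.fromBlocks (A x) 0 0 (B x) with hE₀
  set Z : (Fin n → ℝ) → Matrix (Idx n) (Idx n) ℝ := fun x => skewBlock k (Y x) with hZdef
  have hZs : MatSmooth U Z :=
    (MatSmooth.const 0).fromBlocks hY ((MatSmooth.const _).mul hY.transpose).neg (.const 0)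
  let Zc : (Fin n → ℝ) → Matrix (Idx n) (Idx n) ℂ := fun x => (Z x).map Complex.ofReal
  let Ec : (Fin n → ℝ) → Matrix (Idx n) (Idx n) ℂ := fun x => (E₀ x).map Complex.ofReal
  have hZc : ContDiffOn ℝ ∞ Zc U := matSmooth_iff_contDiffOn.1 hZs.map_ofReal
  have hEc : MatSmooth U Ec := hE.map_ofReal
  have hZpd : ∀ x ∈ U, ∀ i, pd i Zc x = (matPd i Z x).map Complex.ofReal := by
    intro x hx i
    rw [← matPd_eq_pd (differentiableAt_of_contDiffOn hU hZc hx), matPd_map_ofReal hU hZs hx]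
  -- the right inverse of `E₀` given by the invariant form
  have hinv : ∀ x ∈ U, E₀ x * (gramReal n k * (E₀ x)ᵀ * gramReal n k) = 1 := by
    intro x hx
    rw [← Matrix.mul_assoc, ← Matrix.mul_assoc, hgram x hx, gramReal_mul_self]
  -- the `∂ᵢZ` commute because they are simultaneously conjugate to the `aᵢ`
  have hcomm : ∀ x ∈ U, ∀ i j, Commute (pd i Zc x) (pd j Zc x) := by
    intro x hx i j
    have hconj : ∀ i, matPd i Z x = E₀ x * a k i * (gramReal n k * (E₀ x)ᵀ * gramReal n k) := by
      intro i
      rw [← hZE x hx i, Matrix.mul_assoc, hinv x hx, Matrix.mul_one]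
    have hmul : ∀ i j, matPd i Z x * matPd j Z x =
        E₀ x * (a k i * a k j) * (gramReal n k * (E₀ x)ᵀ * gramReal n k) := by
      intro i j
      rw [hconj j, Matrix.mul_assoc (E₀ x), ← Matrix.mul_assoc (matPd i Z x), hZE x hx i]
      simp only [hE₀, Matrix.mul_assoc]
    rw [hZpd x hx, hZpd x hx, Commute, SemiconjBy, ← map_ofReal_mul, ← map_ofReal_mul, hmul, hmul,
      sub_eq_zero.1 (comm_a_a (k := k) i j)]
  obtain ⟨G, hG⟩ := exists_isIteratedPrimitive hU hUs hZc
    (fun x hx => commute_fderiv (hcomm x hx)) 0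
  have hGs : ∀ z, ContDiffOn ℝ ∞ (genSeries G z) U :=
    fun z => hG.contDiffOn_genSeries hU hUc hZc hU0 z
  have hGs' : ∀ z, MatSmooth U (genSeries G z) := fun z => matSmooth_iff_contDiffOn.2 (hGs z)
  have hGpd : ∀ z, ∀ x ∈ U, ∀ i, matPd i (genSeries G z) x =
      z • (genSeries G z x * (matPd i Z x).map Complex.ofReal) := by
    intro z x hx i
    rw [matPd_eq_pd (differentiableAt_of_contDiffOn hU (hGs z) hx), pd,
      (hG.hasFDerivAt_genSeries hU hUc hZc hU0 z hx).fderiv, mulForm_apply, ← hZpd x hx,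
      smul_mul_assoc]
    rfl
  have hmem : ∀ z, ∀ x ∈ U, genSeries G z x * gram n k * (genSeries G z x)ᵀ = gram n k := by
    intro z x hx
    have hs := hGs' z
    rw [eq_of_matPd_eq_zero hU hUc
      (M := fun x => genSeries G z x * gram n k * (genSeries G z x)ᵀ)
      ((hs.mul (.const _)).mul hs.transpose) (fun y hy i => ?_) hx hU0, hG.genSeries_base]
    · simp
    · -- `∂ᵢZ` is skew with respect to the form
      have hskew : matPd i Z y * gramReal n k + gramReal n k * (matPd i Z y)ᵀ = 0 := by
        rw [hZdef]
        rw [matPd_skewBlock hU hY hy, skewBlock, gramReal,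
          Matrix.fromBlocks_transpose, Matrix.fromBlocks_multiply, Matrix.fromBlocks_multiply,
          Matrix.fromBlocks_add]
        simp [J_transpose, ← Matrix.mul_assoc]
      have hskew' : (matPd i Z y).map Complex.ofReal * gram n k +
          gram n k * ((matPd i Z y).map Complex.ofReal)ᵀ = 0 := by
        rw [gram_eq, ← Matrix.transpose_map, ← map_ofReal_mul, ← map_ofReal_mul,
          ← Matrix.map_add _ Complex.ofReal_add, hskew]
        ext; simp
      rw [matPd_mul hU (hs.mul (.const _)) hs.transpose hy, matPd_mul_const hU hs _ hy,
        matPd_transpose, hGpd z y hy, Matrix.transpose_smul, Matrix.transpose_mul]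
      calc _ = z • (genSeries G z y * ((matPd i Z y).map Complex.ofReal * gram n k +
            gram n k * ((matPd i Z y).map Complex.ofReal)ᵀ) * (genSeries G z y)ᵀ) := by
            simp only [Matrix.mul_add, Matrix.add_mul, Matrix.mul_assoc, Matrix.smul_mul,
              Matrix.mul_smul, smul_add]
        _ = 0 := by rw [hskew']; simp
  have hgramE : ∀ z, ∀ x ∈ U, (genSeries G z x * Ec x) * gram n k * (genSeries G z x * Ec x)ᵀ =
      gram n k := by
    intro z x hx
    have h1 : Ec x * gram n k * (Ec x)ᵀ = gram n k := by
      rw [gram_eq, ← Matrix.transpose_map, ← map_ofReal_mul, ← map_ofReal_mul, hgram x hx]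
    calc _ = genSeries G z x * (Ec x * gram n k * (Ec x)ᵀ) * (genSeries G z x)ᵀ := by
          simp only [Matrix.transpose_mul, Matrix.mul_assoc]
      _ = _ := by rw [h1, hmem z x hx]
  have hgg : gram n k * gram n k = 1 := by
    rw [gram_eq, ← map_ofReal_mul, gramReal_mul_self]
    ext p q; simp [Matrix.one_apply]; split_ifs <;> simp
  have hright : ∀ z, ∀ x ∈ U, (genSeries G z x * Ec x) *
      (gram n k * (genSeries G z x * Ec x)ᵀ * gram n k) = 1 := by
    intro z x hx
    rw [← Matrix.mul_assoc, ← Matrix.mul_assoc, hgramE z x hx, hgg]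
  have hdetE : ∀ z, ∀ x ∈ U, IsUnit (genSeries G z x * Ec x).det := fun z x hx =>
    (Matrix.isUnit_iff_isUnit_det _).1 (IsUnit.of_mul_eq_one _ (hright z x hx))
  refine ⟨fun z x => genSeries G z x * Ec x,
    ⟨fun z p q => (hGs' z).mul hEc p q, ?_, ?_, ?_, ?_, ?_⟩, ?_⟩
  · -- holomorphic in `λ`
    intro x hx p q
    simp only [Matrix.mul_apply]
    refine Differentiable.fun_sum fun r _ => Differentiable.mul_const ?_ _
    exact (LinearMap.toContinuousLinearMap (Matrix.entryLinearMap ℂ ℂ p r)).differentiable.comp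
      (hG.differentiable_genSeries hU hUc hZc hU0 hx)
  · -- values in the group
    intro z x hx
    have h4 := mul_eq_one_comm.1 (hright z x hx)
    calc _ = gram n k * (gram n k * (genSeries G z x * Ec x)ᵀ * gram n k *
          (genSeries G z x * Ec x)) := by
          simp only [← Matrix.mul_assoc, hgg, Matrix.one_mul]
      _ = gram n k := by rw [h4, Matrix.mul_one]
  · -- the linear system
    intro z x hx i
    have h1 : matPd i (fun x => genSeries G z x * Ec x) x =
        genSeries G z x * Ec x * lax k F γ z i x := by
      rw [matPd_mul hU (hGs' z) hEc hx, hGpd z x hx, lax, matPd_map_ofReal hU hE hx, hEv x hx,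
        map_ofReal_mul, Matrix.mul_add, Matrix.mul_smul, Matrix.smul_mul]
      have h2 := congrArg (fun M => M.map Complex.ofReal) (hZE x hx i)
      simp only [map_ofReal_mul] at h2
      rw [Matrix.mul_assoc, Matrix.mul_assoc, Matrix.mul_assoc, h2]
    rw [h1, Matrix.nonsing_inv_mul_cancel_left _ _ (hdetE z x hx)]
  · -- the reality condition: conjugation fixes `dZ` and `E₀`
    intro z x hx
    let σ : Matrix (Idx n) (Idx n) ℂ →+* Matrix (Idx n) (Idx n) ℂ := (starRingEnd ℂ).mapMatrix
    have hσ : Continuous σ := continuous_id.matrix_map Complex.continuous_conj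
    have hc : ∀ y ∈ U, ∀ i, σ (pd i Zc y) = (1 : ℝ) • pd i Zc y := by
      intro y hy i
      rw [hZpd y hy, one_smul]
      ext p q
      exact Complex.conj_ofReal _
    have hs : ∀ M : Matrix (Idx n) (Idx n) ℂ, σ (starRingEnd ℂ z • M) = z • σ M := by
      intro M
      ext p q
      simp [σ]
    have h1 : σ (genSeries G (starRingEnd ℂ z) x) = genSeries G z x :=
      hG.map_genSeries hU hUc hZc hU0 σ hσ 1 (fun y hy => map_fderiv_eq_smul hσ (hc y hy))
        (w' := z) hs (by simp) hx
    have h2 : (Ec x).map (starRingEnd ℂ) = Ec x := by ext p q; simp [Ec]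
    change σ (genSeries G (starRingEnd ℂ z) x * Ec x) = _
    rw [map_mul, h1]
    exact congrArg _ h2
  · -- the twisting condition: the involution negates `dZ` and fixes `E₀`
    intro z x hx
    have hσ : Continuous (involHom n) := by
      change Continuous fun M : Matrix (Idx n) (Idx n) ℂ => invol n * (M * invol n)
      fun_prop
    have hc : ∀ y ∈ U, ∀ i, involHom n (pd i Zc y) = (-1 : ℝ) • pd i Zc y := by
      intro y hy i
      rw [hZpd y hy, hZdef, matPd_skewBlock hU hY hy]
      exact involHom_skewBlock _
    have hs : ∀ M : Matrix (Idx n) (Idx n) ℂ, involHom n (-z • M) = -z • involHom n M := by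
      intro M
      rw [involHom_apply, involHom_apply, Matrix.smul_mul, Matrix.mul_smul]
    have h1 : involHom n (genSeries G (-z) x) = genSeries G z x :=
      hG.map_genSeries hU hUc hZc hU0 (involHom n) hσ (-1)
        (fun y hy => map_fderiv_eq_smul hσ (hc y hy)) (w' := -z) hs (by simp) hx
    have h2 : invol n * Ec x * invol n = Ec x := by
      simp only [Ec, hE₀, invol]
      rw [Matrix.fromBlocks_map, Matrix.fromBlocks_multiply, Matrix.fromBlocks_multiply]
      simp
    rw [Matrix.inv_eq_right_inv invol_mul_self]
    calc _ = (invol n * (genSeries G (-z) x * invol n)) * (invol n * Ec x * invol n) := by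
          simp only [Matrix.mul_assoc]
          rw [← Matrix.mul_assoc (invol n) (invol n), invol_mul_self, Matrix.one_mul]
      _ = _ := by rw [← involHom_apply, h1, h2]
  · -- the derivative at `λ = 0` is `G 1 * E₀ = Z * E₀`
    intro x hx
    have hZ0 : Zc 0 = 0 := by
      simp only [Zc, hZdef, skewBlock, hY0]
      ext (p | p) (q | q) <;> simp
    have h0 : genSeries G 0 x = 1 := by
      rw [genSeries, tsum_eq_single 0]
      · simp [hG.zero]
      · intro m hm; simp [hm]
    have hd : (Matrix.of fun p q => deriv (fun z => (genSeries G z x * Ec x) p q) 0) =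
        Zc x * Ec x := by
      have h1 : HasDerivAt (fun z => genSeries G z x) (Zc x) 0 := by
        rw [← hG.apply_one hU hUc hZc hU0 hZ0 x hx, ← hG.deriv_genSeries_zero hU hUc hZc hU0 hx]
        exact (hG.differentiable_genSeries hU hUc hZc hU0 hx 0).hasDerivAt
      ext p q
      have h2 := h1.mul_const (Ec x)
      have h3 := ((LinearMap.toContinuousLinearMap
        (Matrix.entryLinearMap ℂ ℂ p q)).hasFDerivAt.comp_hasDerivAt (0 : ℂ) h2)
      exact h3.deriv
    rw [symMap, hd, h0, Matrix.one_mul, Matrix.mul_assoc, Matrix.mul_nonsing_inv, Matrix.mul_one]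
    simpa [h0] using hdetE 0 x hx

end Extended

end Isothermic

theorem mainTheorem2 (n k : ℕ) (hk : 1 ≤ k) (hkn : k < n)
    (U : Set (Fin n → ℝ)) (hU : IsOpen U) (hU0 : (0 : Fin n → ℝ) ∈ U)
    (hUs : IsSimplyConnected U)
    (f : Fin n → (Fin n → ℝ) → EuclideanSpace ℝ (Fin (n + 1)))
    (hf : Isothermic.IsCombescureSequence k U f) (hf0 : ∀ l, f l 0 = 0) :
    ∃ (F : (Fin n → ℝ) → Matrix (Fin n) (Fin n) ℝ) (γ : (Fin n → ℝ) → Fin n → ℝ)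
      (C : Module.Basis (Fin n) ℝ (Fin n → ℝ)),
      Isothermic.IsSolution k U F γ ∧
      (∀ l, Isothermic.IsNull k (C l)) ∧
      Isothermic.IsConstructedFrom k U F γ (fun l => C l) f := by
  open Isothermic in
  have hUc : IsPreconnected U := hUs.isPathConnected.isConnected.isPreconnected
  obtain ⟨g, W, h, hW, hG⟩ := exists_isFrame (hk.trans_lt hkn).le hU hf
  have hiso := hf.isothermic
  have hfs : ∀ l a, ContDiffOn ℝ ∞ (fun y => f l y a) U := fun l a =>
    (EuclideanSpace.proj (𝕜 := ℝ) a).contDiff.comp_contDiffOn (hiso l).smooth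
  let F : (Fin n → ℝ) → Matrix (Fin n) (Fin n) ℝ :=
    fun x => Matrix.of fun i j => xiMat k g x i j.castSucc
  let γ : (Fin n → ℝ) → Fin n → ℝ := fun x i => xiMat k g x i (Fin.last n)
  have hv : vMap k F γ = fun x => pElt k (xiMat k g x) :=
    funext fun x => congrArg (pElt k) (joinCol_init_last _)
  have hξ : MatSmooth U (xiMat k g) := h.smooth_xiMat hU
  have hvs : MatSmooth U (vMap k F γ) := by
    rw [hv]
    exact (MatSmooth.const 0).fromBlocks (hξ.transpose.mul (.const _)).neg hξ (.const 0)
  have hEv : ∀ x ∈ U, ∀ i, matPd i (blockFrame g W) x =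
      blockFrame g W x * comm (a k i) (vMap k F γ x) := by
    intro x hx i
    rw [hv]
    exact h.matPd_blockFrame hU hiso hfs hG hx i
  have hgram := fun x (hx : x ∈ U) => h.blockFrame_gram hU hUc hU0 hfs hG (hW 0 hU0) hx
  have hunit : ∀ x ∈ U, IsUnit (blockFrame g W x) := fun x hx =>
    IsUnit.of_mul_eq_one (gramReal n k * (blockFrame g W x)ᵀ * gramReal n k) (by
      rw [← Matrix.mul_assoc, ← Matrix.mul_assoc, hgram x hx, gramReal_mul_self])
  have hsol : IsSolution k U F γ :=
    { smooth_F := fun i j => hξ i j.castSucc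
      smooth_γ := contDiffOn_pi.2 fun i => hξ i (Fin.last n)
      diag_zero := fun x hx i => h.xiMat_diag hU hx i
      pde := fun x hx i j _ => pde_of_frame hU h.smooth_blockFrame hvs hunit hEv hx i j }
  -- the null basis consists of the columns of `-J W(0)`
  have hM : IsUnit (-(J n k * W 0)) :=
    ((IsUnit.of_mul_eq_one _ (J_mul_J n k)).mul (hW 0 hU0)).neg
  have : Nonempty (Fin n) := ⟨⟨0, (Nat.zero_le k).trans_lt hkn⟩⟩
  let C : Module.Basis (Fin n) ℝ (Fin n → ℝ) := basisOfLinearIndependentOfCardEqFinrank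
    (Matrix.linearIndependent_cols_iff_isUnit.2 hM) (by simp)
  have hC : ∀ l p, C l p = -(eps n k p * W 0 p l) := by
    intro l p
    have hcol : ⇑C = (-(J n k * W 0)).col := coe_basisOfLinearIndependentOfCardEqFinrank _ _
    rw [hcol]
    simp [J, Matrix.col]
  have hnull : ∀ l, IsNull k (C l) := by
    intro l
    rw [IsNull, J, dotProduct, ← hG 0 hU0 l]
    refine Finset.sum_congr rfl fun p _ => ?_
    rw [Matrix.mulVec_diagonal, hC]
    linear_combination (eps n k p * W 0 p l ^ 2) * eps_mul_self n k p
  have hY0 : immersionMat k f (W 0) 0 = 0 := by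
    have h0 : (Matrix.of fun a l => f l 0 a : Matrix (Fin (n + 1)) (Fin n) ℝ) = 0 := by
      ext a l
      simp [hf0]
    rw [immersionMat, h0, Matrix.zero_mul]
  obtain ⟨E, hE, hsym⟩ := exists_extendedFrame (F := F) (γ := γ) hU hUs hU0
    (smooth_immersionMat hfs (W 0)) hY0 h.smooth_blockFrame hgram hEv
    (fun x hx i => h.matPd_skewBlock_mul hU hUc hU0 hfs hG (hW 0 hU0) hx i)
  refine ⟨F, γ, C, hsol, hnull, E, immersionMat k f (W 0), hE, hsym, fun l x hx => ?_⟩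
  ext a
  have h1 := congrFun (congrFun (immersionMat_mul k f (hW 0 hU0) x) a) l
  rw [Matrix.of_apply] at h1
  rw [← h1, Matrix.mul_apply]
  change _ = ∑ p, _ * C l p
  refine Finset.sum_congr rfl fun p _ => ?_
  rw [hC]
  simp [J]
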